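/- **Setting.** A *Bratteli diagram* $\mathrm{Br}$ is a directed graph whose vertex set is a disjoint union of finite levels $\mathrm{Br}_0,\mathrm{Br}_1,\mathrm{Br}_2,\dots$, where $\mathrm{Br}_0=\{v_0\}$, every arrow emitted from $\mathrm{Br}_n$ ends in $\mathrm{Br}_{n+1}$, every vertex emits finitely many and at least one arrow, and $v_0$ is the only source. A *potential* is a real-valued function $F$ on the arrows; put $F(\mu)=\sum_{i=1}^n F(a_i)$ for a finite path $\mu=a_1a_2\cdots a_n$ starting at $v_0$, and let $r(\mu)$ be the vertex where $\mu$ ends. $AF(\mathrm{Br})$ is the unital AF $C^*$-algebra of $\mathrm{Br}$. It is the closed linear span of matrix units $E^n_{\mu,\mu'}$ ($n\ge 0$; $\mu,\mu'$ paths of length $n$ from $v_0$ with $r(\mu)=r(\mu')$), where the $E^n_{\mu,\mu'}$ with $n$ fixed are non-zero matrix units with $\sum_\mu E^n_{\mu,\mu}=1$, and $E^n_{\mu,\mu'}=\sum_a E^{n+1}_{\mu a,\mu' a}$, the sum being over the arrows $a$ with source $r(\mu)$. The action $\alpha^F=(\alpha^F_t)_{t\in\mathbb R}$ is the continuous one-parameter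 group of automorphisms of $AF(\mathrm{Br})$ with $\alpha^F_t(E^n_{\mu,\mu'})=e^{it(F(\mu)-F(\mu'))}E^n_{\mu,\mu'}$. A *generalized gauge action* on a unital $C^*$-algebra is a continuous one-parameter group of automorphisms which is conjugate, via a $*$-isomorphism, to $\alpha^F$ on $AF(\mathrm{Br})$ for some Bratteli diagram $\mathrm{Br}$ and some potential $F$. For a continuous one-parameter group $\alpha$ of automorphisms of a unital $C^*$-algebra $A$ and $\beta\in\mathbb R$, a *$\beta$-KMS state* is a state $\omega$ of $A$ with $\omega(ab)=\omega(b\,\alpha_{i\beta}(a))$ for all $a,b\in A$ that are (entire) analytic for $\alpha$. The set $S^\alpha_\beta$ of $\beta$-KMS states is a convex set, equipped with the weak* topology; write $S^F_\beta$ for $S^{\alpha^F}_\beta$. **Lemma 5.4.** Let $\mathrm{Br}$ and $\mathrm{Br}'$ be Bratteli diagrams with potentials $F$ and $F'$, and let $AF(\mathrm{Br})\otimes AF(\mathrm{Br}')$ be the (spatial) $C^*$-tensor product. 1. There is exactly one continuous one-parameter group $\alpha$ of automorphisms of $AF(\mathrm{Br})\otimes AF(\mathrm{Br}')$ with $\alpha_t(a\otimes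 b)=\alpha^F_t(a)\otimes\alpha^{F'}_{-t}(b)$ for all $t\in\mathbb R$, $a\in AF(\mathrm{Br})$, $b\in AF(\mathrm{Br}')$, and $\alpha$ is a generalized gauge action. 2. Let $\beta\in\mathbb R$ and assume that $\alpha^{F'}$ has a unique $(-\beta)$-KMS state $\omega'$. Then $\omega\mapsto\omega\otimes\omega'$, where $(\omega\otimes\omega')(a\otimes b)=\omega(a)\omega'(b)$, is a well-defined affine homeomorphism from $S^F_\beta$ onto $S^\alpha_\beta$. -/

import Mathlib

open scoped lp TensorProduct

/-- A Bratteli diagram: `Vertex n` is the `n`-th level, `Arrow n` the set of arrows from level `n`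
to level `n + 1`. All levels are finite, level `0` is a single vertex, there are no sinks, and the
top vertex is the only source. -/
structure BratteliDiagram where
  Vertex : ℕ → Type
  Arrow : ℕ → Type
  src : ∀ {n : ℕ}, Arrow n → Vertex n
  rng : ∀ {n : ℕ}, Arrow n → Vertex (n + 1)
  finite_vertex : ∀ n, Finite (Vertex n)
  finite_emitted : ∀ {n : ℕ} (v : Vertex n), {a : Arrow n | src a = v}.Finite
  top : Vertex 0
  eq_top : ∀ v : Vertex 0, v = top
  no_sinks : ∀ {n : ℕ} (v : Vertex n), ∃ a : Arrow n, src a = v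
  no_other_sources : ∀ {n : ℕ} (v : Vertex (n + 1)), ∃ a : Arrow n, rng a = v

namespace BratteliDiagram

variable (Br : BratteliDiagram)

/-- A potential: a real-valued function on the arrows. -/
abbrev Potential : Type := ∀ n : ℕ, Br.Arrow n → ℝ

/-- Infinite paths starting at the top vertex. -/
@[ext]
structure InfPath where
  arrow : ∀ i : ℕ, Br.Arrow i
  comp : ∀ i : ℕ, Br.rng (arrow i) = Br.src (arrow (i + 1))

/-- Finite paths of length `n` starting at the top vertex. -/
@[ext]
structure FinPath (n : ℕ) where
  arrow : ∀ i : ℕ, i < n → Br.Arrow i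
  comp : ∀ (i : ℕ) (h : i + 1 < n), Br.rng (arrow i (Nat.lt_of_succ_lt h)) = Br.src (arrow (i + 1) h)

variable {Br}

/-- The vertex in which a finite path ends. -/
def FinPath.range : {n : ℕ} → Br.FinPath n → Br.Vertex n
  | 0, _ => Br.top
  | n + 1, μ => Br.rng (μ.arrow n n.lt_succ_self)

/-- The value `F(μ) = F(a₁) + ⋯ + F(aₙ)` of a potential on a finite path `μ = a₁ ⋯ aₙ`. -/
noncomputable def FinPath.energy (F : Br.Potential) {n : ℕ} (μ : Br.FinPath n) : ℝ :=
  ∑ i : Fin n, F i (μ.arrow i i.isLt)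

/-- The infinite path `x` begins with the finite path `μ`. -/
def InfPath.StartsWith {n : ℕ} (x : Br.InfPath) (μ : Br.FinPath n) : Prop :=
  ∀ (i : ℕ) (h : i < n), x.arrow i = μ.arrow i h

theorem InfPath.StartsWith.range_eq {n : ℕ} {x : Br.InfPath} {μ : Br.FinPath n}
    (h : x.StartsWith μ) : μ.range = Br.src (x.arrow n) := by
  cases n with
  | zero => exact (Br.eq_top _).symm
  | succ n =>
    change Br.rng (μ.arrow n _) = _
    rw [← h n n.lt_succ_self, x.comp]

open Classical in
/-- Replace the first `n` arrows of `x` by the finite path `ν`. -/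
noncomputable def InfPath.replace {n : ℕ} (x : Br.InfPath) (ν : Br.FinPath n)
    (h : ν.range = Br.src (x.arrow n)) : Br.InfPath where
  arrow i := if hi : i < n then ν.arrow i hi else x.arrow i
  comp i := by
    by_cases h1 : i + 1 < n
    · have h0 : i < n := by omega
      simp only [h1, h0, dif_pos]
      exact ν.comp i h1
    · by_cases h0 : i < n
      · obtain rfl : n = i + 1 := by omega
        simp only [h0, h1, dif_pos, dif_neg, not_false_eq_true]
        exact h
      · simp only [h0, h1, dif_neg, not_false_eq_true]
        exact x.comp i

theorem InfPath.replace_startsWith {n : ℕ} (x : Br.InfPath) (ν : Br.FinPath n)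
    (h : ν.range = Br.src (x.arrow n)) : (x.replace ν h).StartsWith ν := by
  intro i hi
  simp [InfPath.replace, hi]

theorem InfPath.replace_tail {n : ℕ} (x : Br.InfPath) (ν : Br.FinPath n)
    (h : ν.range = Br.src (x.arrow n)) (i : ℕ) (hi : n ≤ i) :
    (x.replace ν h).arrow i = x.arrow i := by
  simp [InfPath.replace, hi.not_gt]

theorem InfPath.replace_replace {n : ℕ} {x : Br.InfPath} {μ ν : Br.FinPath n}
    (hx : x.StartsWith μ) (h : ν.range = Br.src (x.arrow n))
    (h' : μ.range = Br.src ((x.replace ν h).arrow n)) : (x.replace ν h).replace μ h' = x := by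
  ext i
  by_cases hi : i < n
  · simp [InfPath.replace, hi, hx i hi]
  · simp [InfPath.replace, hi]

open Classical in
/-- For finite paths `μ, ν` of length `n` with the same range: the bijection `μ z ↦ ν z` from the
infinite paths that begin with `μ` onto those that begin with `ν`. -/
noncomputable def swapPrefix {n : ℕ} (μ ν : Br.FinPath n) (h : μ.range = ν.range) :
    Br.InfPath ≃. Br.InfPath where
  toFun x := if hx : x.StartsWith μ then some (x.replace ν (h ▸ hx.range_eq)) else none
  invFun y := if hy : y.StartsWith ν then some (y.replace μ (h ▸ hy.range_eq)) else none
  inv x y := by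
    constructor
    · intro hxy
      by_cases hy : y.StartsWith ν
      · simp only [hy, dif_pos, Option.some.injEq] at hxy
        subst hxy
        have h1 := y.replace_startsWith μ (h ▸ hy.range_eq)
        simp only [h1, dif_pos, Option.some.injEq]
        exact InfPath.replace_replace hy _ _
      · simp [hy] at hxy
    · intro hxy
      by_cases hx : x.StartsWith μ
      · simp only [hx, dif_pos, Option.some.injEq] at hxy
        subst hxy
        have h1 := x.replace_startsWith ν (h ▸ hx.range_eq)
        simp only [h1, dif_pos, Option.some.injEq]
        exact InfPath.replace_replace hx _ _
      · simp [hx] at hxy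

end BratteliDiagram

section PartialIsometry

variable {X : Type*}

theorem sum_pequiv_le (f : X ≃. X) (ξ : ℓ²(X, ℂ)) (s : Finset X) :
    ∑ x ∈ s, ‖((f x).elim 0 ξ : ℂ)‖ ^ (2 : ENNReal).toReal ≤ ‖ξ‖ ^ (2 : ENNReal).toReal := by
  classical
  have hp : 0 < (2 : ENNReal).toReal := by norm_num
  have h0 : ((0 : ℝ) ^ (2 : ENNReal).toReal) = 0 := Real.zero_rpow hp.ne'
  have hs : Set.InjOn f {x ∈ s | (f x).isSome} := by
    intro x hx y hy hxy
    obtain ⟨z, hz⟩ := Option.isSome_iff_exists.1 hx.2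
    exact f.inj (b := z) hz (by rw [← hxy]; exact hz)
  let t : Finset X := (s.filter fun x => (f x).isSome).image fun x => (f x).getD x
  have : ∑ x ∈ s, ‖((f x).elim 0 ξ : ℂ)‖ ^ (2 : ENNReal).toReal
      = ∑ y ∈ t, ‖(ξ y : ℂ)‖ ^ (2 : ENNReal).toReal := by
    rw [Finset.sum_image, Finset.sum_filter]
    · refine Finset.sum_congr rfl fun x _ => ?_
      rcases hfx : f x with _ | y
      · simp
      · simp
    · intro x hx y hy hxy
      rw [Finset.mem_coe, Finset.mem_filter] at hx hy
      refine hs hx hy ?_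
      obtain ⟨z, hz⟩ := Option.isSome_iff_exists.1 hx.2
      obtain ⟨w, hw⟩ := Option.isSome_iff_exists.1 hy.2
      simp only [hz, hw, Option.getD_some] at hxy
      rw [hz, hw, hxy]
  rw [this]
  exact lp.sum_rpow_le_norm_rpow hp ξ t

/-- The partial isometry on `ℓ²(X)` given by a partial bijection `f` of `X`:
`(T ξ)(x) = ξ (f x)` if `f` is defined at `x`, and `(T ξ)(x) = 0` otherwise. -/
noncomputable def pequivOp (f : X ≃. X) : ℓ²(X, ℂ) →L[ℂ] ℓ²(X, ℂ) :=
  LinearMap.mkContinuous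
    { toFun := fun ξ => ⟨fun x => (f x).elim 0 ξ, memℓp_gen' (sum_pequiv_le f ξ)⟩
      map_add' := fun ξ η => by
        ext x
        change (f x).elim 0 (ξ + η : ℓ²(X, ℂ)) = (f x).elim 0 ξ + (f x).elim 0 η
        rcases f x with _ | y
        · exact (add_zero (0 : ℂ)).symm
        · rfl
      map_smul' := fun c ξ => by
        ext x
        change (f x).elim 0 (c • ξ : ℓ²(X, ℂ)) = c * (f x).elim 0 ξ
        rcases f x with _ | y
        · exact (mul_zero c).symm
        · rfl }
    1 (fun ξ => by
      rw [one_mul]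
      exact lp.norm_le_of_forall_sum_le (by norm_num) (norm_nonneg _) (sum_pequiv_le f ξ))

theorem pequivOp_apply (f : X ≃. X) (ξ : ℓ²(X, ℂ)) (x : X) :
    pequivOp f ξ x = (f x).elim 0 ξ := rfl

theorem norm_phase_mul (θ : ℝ) (z : ℂ) : ‖Complex.exp (θ * Complex.I) * z‖ = ‖z‖ := by
  rw [norm_mul, Complex.norm_exp_ofReal_mul_I, one_mul]

theorem memℓp_phase (θ : X → ℝ) (ξ : ℓ²(X, ℂ)) :
    Memℓp (fun x => Complex.exp (θ x * Complex.I) * ξ x) 2 := by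
  refine memℓp_gen ?_
  simp only [norm_phase_mul]
  exact (lp.memℓp ξ).summable (by norm_num)

/-- Multiplication by the function `exp (i θ(x))` on `ℓ²(X)`. -/
noncomputable def phaseMul (θ : X → ℝ) (ξ : ℓ²(X, ℂ)) : ℓ²(X, ℂ) :=
  ⟨fun x => Complex.exp (θ x * Complex.I) * ξ x, memℓp_phase θ ξ⟩

theorem phaseMul_apply (θ : X → ℝ) (ξ : ℓ²(X, ℂ)) (x : X) :
    phaseMul θ ξ x = Complex.exp (θ x * Complex.I) * ξ x := rfl

theorem phaseMul_phaseMul (θ θ' : X → ℝ) (ξ : ℓ²(X, ℂ)) :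
    phaseMul θ (phaseMul θ' ξ) = phaseMul (fun x => θ x + θ' x) ξ := by
  ext x
  rw [phaseMul_apply, phaseMul_apply, phaseMul_apply, ← mul_assoc, ← Complex.exp_add]
  push_cast
  ring_nf

theorem phaseMul_zero (ξ : ℓ²(X, ℂ)) : phaseMul (fun _ => 0) ξ = ξ := by
  ext x
  rw [phaseMul_apply]
  simp

/-- The diagonal unitary on `ℓ²(X)` with diagonal entries `exp (i θ(x))`. -/
noncomputable def phaseUnitary (θ : X → ℝ) : ℓ²(X, ℂ) ≃ₗᵢ[ℂ] ℓ²(X, ℂ) where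
  toFun := phaseMul θ
  invFun := phaseMul fun x => -θ x
  map_add' ξ η := by ext x; exact mul_add _ _ _
  map_smul' c ξ := by ext x; exact mul_left_comm _ _ _
  left_inv ξ := by simp [phaseMul_phaseMul, phaseMul_zero]
  right_inv ξ := by simp [phaseMul_phaseMul, phaseMul_zero]
  norm_map' ξ := by
    change ‖phaseMul θ ξ‖ = ‖ξ‖
    rw [lp.norm_eq_tsum_rpow (by norm_num), lp.norm_eq_tsum_rpow (by norm_num)]
    simp only [phaseMul_apply, norm_phase_mul]

end PartialIsometry

/-- The (closed, unital) `C*`-subalgebra generated by a subset of a unital `C*`-algebra. -/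
noncomputable def cstarGenerated {B : Type*} [CStarAlgebra B] (G : Set B) : StarSubalgebra ℂ B :=
  (StarAlgebra.adjoin ℂ G).topologicalClosure

instance cstarGenerated_isClosed {B : Type*} [CStarAlgebra B] (G : Set B) :
    IsClosed (cstarGenerated G : Set B) :=
  StarSubalgebra.isClosed_topologicalClosure _

theorem mem_cstarGenerated {B : Type*} [CStarAlgebra B] {G : Set B} {g : B} (hg : g ∈ G) :
    g ∈ cstarGenerated G :=
  StarSubalgebra.le_topologicalClosure _ (StarAlgebra.subset_adjoin ℂ _ hg)

theorem starAlgEquiv_ext_of_generators {B : Type*} [CStarAlgebra B] {G : Set B}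
    {φ ψ : cstarGenerated G ≃⋆ₐ[ℂ] cstarGenerated G}
    (h : ∀ (g : B) (hg : g ∈ G),
      φ ⟨g, mem_cstarGenerated hg⟩ = ψ ⟨g, mem_cstarGenerated hg⟩) : φ = ψ := by
  have key : ∀ (x : B) (hx : x ∈ StarAlgebra.adjoin ℂ G),
      φ ⟨x, StarSubalgebra.le_topologicalClosure _ hx⟩
        = ψ ⟨x, StarSubalgebra.le_topologicalClosure _ hx⟩ := by
    intro x hx
    induction hx using StarAlgebra.adjoin_induction with
    | mem g hg => exact h g hg
    | algebraMap r =>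
      exact (AlgHomClass.commutes φ r).trans (AlgHomClass.commutes ψ r).symm
    | add x y hx hy ihx ihy =>
      have e := congrArg₂ (· + ·) ihx ihy
      exact ((map_add φ _ _).trans e).trans (map_add ψ _ _).symm
    | mul x y hx hy ihx ihy =>
      have e := congrArg₂ (· * ·) ihx ihy
      exact ((map_mul φ _ _).trans e).trans (map_mul ψ _ _).symm
    | star x hx ihx =>
      have e := congrArg star ihx
      exact ((map_star φ _).trans e).trans (map_star ψ _).symm
  exact StarAlgHomClass.ext_topologicalClosure (StarAlgEquiv.isometry φ).continuous
    (StarAlgEquiv.isometry ψ).continuous fun x => key x x.2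

/-- A continuous one-parameter group of automorphisms of a unital `C*`-algebra. -/
structure CStarFlow (A : Type*) [CStarAlgebra A] where
  toFun : ℝ → A ≃⋆ₐ[ℂ] A
  map_zero : ∀ a, toFun 0 a = a
  map_add : ∀ s t a, toFun (s + t) a = toFun s (toFun t a)
  continuous : ∀ a, Continuous fun t => toFun t a

instance (A : Type*) [CStarAlgebra A] : CoeFun (CStarFlow A) fun _ => ℝ → A ≃⋆ₐ[ℂ] A := ⟨CStarFlow.toFun⟩

theorem CStarFlow.ext {A : Type*} [CStarAlgebra A] {α α' : CStarFlow A} (h : ∀ t a, α t a = α' t a) :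
    α = α' := by
  cases α
  cases α'
  congr
  funext t
  exact StarAlgEquiv.ext (h t)

section KMS

variable {A : Type*} [CStarAlgebra A]

/-- `f` is the entire function `z ↦ α_z(a)`, i.e. an entire extension of `t ↦ α_t(a)`. -/
def IsEntireExtension (α : CStarFlow A) (a : A) (f : ℂ → A) : Prop :=
  Differentiable ℂ f ∧ ∀ t : ℝ, f t = α t a

/-- The element `a` is (entire) analytic for the flow `α`. -/
def IsAnalyticFor (α : CStarFlow A) (a : A) : Prop := ∃ f : ℂ → A, IsEntireExtension α a f

open scoped ComplexOrder in
/-- A state of a unital `C*`-algebra: a positive linear functional with value `1` at the unit. -/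
def IsState (ω : WeakDual ℂ A) : Prop := (∀ a : A, 0 ≤ ω (star a * a)) ∧ ω 1 = 1

/-- The set of `β`-KMS states for `α`, with `ω(ab) = ω(b α_{iβ}(a))` for all analytic `a, b`.
As a set of elements of `WeakDual ℂ A`, it carries the weak* topology. -/
def kmsStates (α : CStarFlow A) (β : ℝ) : Set (WeakDual ℂ A) :=
  {ω | IsState ω ∧ ∀ (a b : A) (f : ℂ → A), IsEntireExtension α a f → IsAnalyticFor α b →
    ω (a * b) = ω (b * f (Complex.I * β))}

open scoped ComplexOrder in
theorem convex_kmsStates (α : CStarFlow A) (β : ℝ) : Convex ℝ (kmsStates α β) := by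
  intro ω hω ω' hω' s t hs ht hst
  have e : ∀ a : A, (s • ω + t • ω') a = (s : ℂ) * ω a + (t : ℂ) * ω' a := fun a => rfl
  refine ⟨⟨fun a => ?_, ?_⟩, fun a b f hf hb => ?_⟩
  · rw [e]
    exact add_nonneg (mul_nonneg (by exact_mod_cast hs) (hω.1.1 a))
      (mul_nonneg (by exact_mod_cast ht) (hω'.1.1 a))
  · rw [e, hω.1.2, hω'.1.2, mul_one, mul_one]
    exact_mod_cast hst
  · rw [e, e, hω.2 a b f hf hb, hω'.2 a b f hf hb]

end KMS

/-- A map between convex sets is affine. -/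
def IsAffineMapOn {E E' : Type*} [AddCommGroup E] [Module ℝ E] [AddCommGroup E'] [Module ℝ E']
    {S : Set E} (hS : Convex ℝ S) {S' : Set E'} (Φ : S → S') : Prop :=
  ∀ (x y : S) (s t : ℝ) (hs : 0 ≤ s) (ht : 0 ≤ t) (hst : s + t = 1),
    (Φ ⟨s • (x : E) + t • (y : E), hS x.2 y.2 hs ht hst⟩ : E') = s • (Φ x : E') + t • (Φ y : E')

section SpatialTensor

variable {H K : Type*} [NormedAddCommGroup H] [InnerProductSpace ℂ H] [CompleteSpace H]
  [NormedAddCommGroup K] [InnerProductSpace ℂ K] [CompleteSpace K]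

variable (H K) in
/-- The Hilbert space tensor product of `H` and `K`. -/
abbrev HilbertTensor : Type _ := UniformSpace.Completion (H ⊗[ℂ] K)

/-- The operator `a ⊗ b` on the Hilbert space tensor product. -/
noncomputable def opTensor (a : H →L[ℂ] H) (b : K →L[ℂ] K) :
    HilbertTensor H K →L[ℂ] HilbertTensor H K :=
  (TensorProduct.mapL a b).completion

/-- The spatial (i.e. minimal) tensor product of two concrete `C*`-algebras `A ⊆ B(H)` and
`B ⊆ B(K)`: the closed `*`-subalgebra of `B(H ⊗ K)` generated by the operators `a ⊗ b`. -/
noncomputable def spatialTensor (A : StarSubalgebra ℂ (H →L[ℂ] H))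
    (B : StarSubalgebra ℂ (K →L[ℂ] K)) :
    StarSubalgebra ℂ (HilbertTensor H K →L[ℂ] HilbertTensor H K) :=
  cstarGenerated {T | ∃ a ∈ A, ∃ b ∈ B, T = opTensor a b}

instance (A : StarSubalgebra ℂ (H →L[ℂ] H)) (B : StarSubalgebra ℂ (K →L[ℂ] K)) :
    IsClosed (spatialTensor A B : Set (HilbertTensor H K →L[ℂ] HilbertTensor H K)) :=
  cstarGenerated_isClosed _

/-- The elementary tensor `a ⊗ b`. -/
noncomputable def elemTensor {A : StarSubalgebra ℂ (H →L[ℂ] H)} {B : StarSubalgebra ℂ (K →L[ℂ] K)}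
    (a : A) (b : B) : spatialTensor A B :=
  ⟨opTensor a b, mem_cstarGenerated ⟨a, a.2, b, b.2, rfl⟩⟩

end SpatialTensor

namespace BratteliDiagram

variable {Br : BratteliDiagram}

/-- The matrix unit `E_{μ,ν}` as an operator on `ℓ²` of the infinite paths; in terms of the
canonical basis it maps `δ_{ν z}` to `δ_{μ z}`, and it annihilates `δ_x` when `x` does not begin
with `ν`. -/
noncomputable def matrixUnitOp {n : ℕ} (μ ν : Br.FinPath n) (h : μ.range = ν.range) :
    ℓ²(Br.InfPath, ℂ) →L[ℂ] ℓ²(Br.InfPath, ℂ) :=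
  pequivOp (swapPrefix μ ν h)

variable (Br) in
/-- The AF-algebra of a Bratteli diagram, faithfully represented on `ℓ²` of the infinite paths: the
`C*`-algebra generated by the matrix units `E_{μ,ν}`, `r(μ) = r(ν)`. Those with `|μ| = |ν| = n`
span a finite dimensional `C*`-algebra that is isomorphic to a direct sum of full matrix algebras
indexed by the `n`-th level, and `E_{μ,ν}` is the sum of the `E_{μa,νa}` over the arrows `a` with
`s(a) = r(μ)`. -/
noncomputable def AF : StarSubalgebra ℂ (ℓ²(Br.InfPath, ℂ) →L[ℂ] ℓ²(Br.InfPath, ℂ)) :=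
  cstarGenerated {T | ∃ (n : ℕ) (μ ν : Br.FinPath n) (h : μ.range = ν.range),
    T = matrixUnitOp μ ν h}

instance : IsClosed (Br.AF : Set (ℓ²(Br.InfPath, ℂ) →L[ℂ] ℓ²(Br.InfPath, ℂ))) :=
  cstarGenerated_isClosed _

/-- The matrix unit `E_{μ,ν}` as an element of the AF-algebra. -/
noncomputable def matrixUnit {n : ℕ} (μ ν : Br.FinPath n) (h : μ.range = ν.range) : Br.AF :=
  ⟨matrixUnitOp μ ν h, mem_cstarGenerated ⟨n, μ, ν, h, rfl⟩⟩

/-- Two infinite paths that agree from some point on. -/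
def tailSetoid (Br : BratteliDiagram) : Setoid Br.InfPath where
  r x y := ∃ n, ∀ i, n ≤ i → x.arrow i = y.arrow i
  iseqv :=
    { refl := fun _ => ⟨0, fun _ _ => rfl⟩
      symm := fun ⟨n, h⟩ => ⟨n, fun i hi => (h i hi).symm⟩
      trans := fun ⟨n, h⟩ ⟨m, h'⟩ => ⟨max n m, fun i hi =>
        (h i (le_trans (le_max_left _ _) hi)).trans (h' i (le_trans (le_max_right _ _) hi))⟩ }

/-- A function on the infinite paths whose difference on tail equivalent paths is the difference of
the energies. -/
theorem exists_phase (F : Br.Potential) : ∃ θ : Br.InfPath → ℝ,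
    ∀ (n : ℕ) (x y : Br.InfPath), (∀ i, n ≤ i → x.arrow i = y.arrow i) →
      θ x - θ y = ∑ i ∈ Finset.range n, (F i (x.arrow i) - F i (y.arrow i)) := by
  let rep : Br.InfPath → Br.InfPath := fun x => (Quotient.mk Br.tailSetoid x).out
  have hrep : ∀ x, ∃ N, ∀ i, N ≤ i → (rep x).arrow i = x.arrow i := fun x =>
    Quotient.exact (s := Br.tailSetoid) (Quotient.out_eq (Quotient.mk Br.tailSetoid x))
  have key : ∀ (x : Br.InfPath) (M : ℕ), (∀ i, M ≤ i → (rep x).arrow i = x.arrow i) →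
      ∑ᶠ i, (F i (x.arrow i) - F i ((rep x).arrow i))
        = ∑ i ∈ Finset.range M, (F i (x.arrow i) - F i ((rep x).arrow i)) := by
    intro x M hM
    refine finsum_eq_sum_of_support_subset _ fun i hi => ?_
    by_contra hcon
    refine hi ?_
    have : M ≤ i := by simpa using hcon
    simp [hM i this]
  refine ⟨fun x => ∑ᶠ i, (F i (x.arrow i) - F i ((rep x).arrow i)), fun n x y hxy => ?_⟩
  have hr : rep x = rep y := congrArg Quotient.out
    (Quotient.sound (s := Br.tailSetoid) ⟨n, hxy⟩)
  obtain ⟨N, hN⟩ := hrep x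
  obtain ⟨N', hN'⟩ := hrep y
  let M := max n (max N N')
  have h1 := key x M fun i hi => hN i (by omega)
  have h2 := key y M fun i hi => hN' i (by omega)
  change ∑ᶠ i, (F i (x.arrow i) - F i ((rep x).arrow i))
    - ∑ᶠ i, (F i (y.arrow i) - F i ((rep y).arrow i)) = _
  rw [h1, h2, hr, ← Finset.sum_sub_distrib]
  symm
  calc _ = ∑ i ∈ Finset.range M, (F i (x.arrow i) - F i (y.arrow i)) := by
        refine Finset.sum_subset (Finset.range_mono (le_max_left _ _)) fun i _ hi => ?_
        have : n ≤ i := by simpa using hi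
        simp [hxy i this]
    _ = _ := Finset.sum_congr rfl fun i _ => by ring

theorem conj_matrixUnitOp (F : Br.Potential) (θ : Br.InfPath → ℝ)
    (hθ : ∀ (n : ℕ) (x y : Br.InfPath), (∀ i, n ≤ i → x.arrow i = y.arrow i) →
      θ x - θ y = ∑ i ∈ Finset.range n, (F i (x.arrow i) - F i (y.arrow i)))
    (t : ℝ) {n : ℕ} (μ ν : Br.FinPath n) (h : μ.range = ν.range) :
    (phaseUnitary fun x => t * θ x).conjStarAlgEquiv (matrixUnitOp μ ν h)
      = Complex.exp (Complex.I * t * (μ.energy F - ν.energy F)) • matrixUnitOp μ ν h := by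
  ext ξ x
  change Complex.exp ((t * θ x : ℝ) * Complex.I) *
      (swapPrefix μ ν h x).elim 0 (phaseMul (fun x => -(t * θ x)) ξ)
    = Complex.exp (Complex.I * t * (μ.energy F - ν.energy F)) * (swapPrefix μ ν h x).elim 0 ξ
  by_cases hx : x.StartsWith μ
  · have e : swapPrefix μ ν h x = some (x.replace ν (h ▸ hx.range_eq)) := dif_pos hx
    have hy := x.replace_startsWith ν (h ▸ hx.range_eq)
    have hd := hθ n x _ fun i hi => (x.replace_tail ν (h ▸ hx.range_eq) i hi).symm
    rw [e]
    generalize x.replace ν (h ▸ hx.range_eq) = y at hy hd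
    change Complex.exp ((t * θ x : ℝ) * Complex.I) *
      (Complex.exp ((-(t * θ y) : ℝ) * Complex.I) * ξ y) = _ * ξ y
    rw [← mul_assoc, ← Complex.exp_add]
    have h3 : θ x - θ y = μ.energy F - ν.energy F := by
      rw [hd, FinPath.energy, FinPath.energy, ← Finset.sum_sub_distrib, Finset.sum_range]
      exact Finset.sum_congr rfl fun i _ => by rw [hx i i.isLt, hy i i.isLt]
    have h4 : ((μ.energy F : ℂ) - ν.energy F) = (θ x : ℂ) - θ y := by
      exact_mod_cast congrArg (fun r : ℝ => (r : ℂ)) h3.symm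
    rw [h4]
    push_cast
    ring_nf
  · have e : swapPrefix μ ν h x = none := dif_neg hx
    rw [e]
    simp

end BratteliDiagram

/-- A one-parameter group of automorphisms of a concrete `C*`-algebra which multiplies each element
of a generating set by a character of `ℝ` restricts to a flow on the generated `C*`-algebra. -/
theorem exists_flow_of_generators {B : Type*} [CStarAlgebra B] (G : Set B)
    (φ : ℝ → B ≃⋆ₐ[ℂ] B) (φ_zero : ∀ a, φ 0 a = a) (φ_add : ∀ s t a, φ (s + t) a = φ s (φ t a))
    (hG : ∀ g ∈ G, ∃ c : ℝ, ∀ t : ℝ, φ t g = Complex.exp (Complex.I * t * c) • g) :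
    ∃ α : CStarFlow (cstarGenerated G), ∀ t a, (α t a : B) = φ t a := by
  have hiso : ∀ t, Isometry (φ t) := fun t => StarAlgEquiv.isometry (φ t)
  have hmem0 : ∀ t, StarAlgebra.adjoin ℂ G ≤ (StarAlgebra.adjoin ℂ G).comap (φ t : B →⋆ₐ[ℂ] B) := by
    intro t
    refine StarAlgebra.adjoin_le fun g hg => ?_
    obtain ⟨c, hc⟩ := hG g hg
    change φ t g ∈ StarAlgebra.adjoin ℂ G
    rw [hc t]
    exact SMulMemClass.smul_mem _ (StarAlgebra.subset_adjoin ℂ G hg)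
  have hmem : ∀ t, ∀ a ∈ cstarGenerated G,
      φ t a ∈ cstarGenerated G := by
    intro t a ha
    exact map_mem_closure (hiso t).continuous ha fun b hb => hmem0 t hb
  have hinv : ∀ t a, φ (-t) (φ t a) = a := fun t a => by
    rw [← φ_add, neg_add_cancel, φ_zero]
  have hinv' : ∀ t a, φ t (φ (-t) a) = a := fun t a => by
    rw [← φ_add, add_neg_cancel, φ_zero]
  have hcont : ∀ a ∈ cstarGenerated G, Continuous fun t => φ t a := by
    have h0 : ∀ a ∈ StarAlgebra.adjoin ℂ G, Continuous fun t => φ t a := by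
      intro a ha
      induction ha using StarAlgebra.adjoin_induction with
      | mem g hg =>
        obtain ⟨c, hc⟩ := hG g hg
        simp only [hc]
        fun_prop
      | algebraMap r => simpa only [AlgHomClass.commutes] using continuous_const
      | add x y _ _ hx hy => simp only [map_add]; exact hx.add hy
      | mul x y _ _ hx hy => simp only [map_mul]; exact hx.mul hy
      | star x _ hx => simpa only [map_star] using hx.star
    intro a ha
    refine continuous_of_uniform_approx_of_continuous fun u hu => ?_
    obtain ⟨ε, hε, hεu⟩ := Metric.mem_uniformity_dist.1 hu
    obtain ⟨b, hb, hab⟩ := Metric.mem_closure_iff.1 ha ε hε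
    exact ⟨fun t => φ t b, h0 b hb, fun t => hεu (by rw [(hiso t).dist_eq]; exact hab)⟩
  refine ⟨⟨fun t =>
    { toFun := fun a => ⟨φ t a, hmem t a a.2⟩
      invFun := fun a => ⟨φ (-t) a, hmem (-t) a a.2⟩
      left_inv := fun a => Subtype.ext (hinv t a)
      right_inv := fun a => Subtype.ext (hinv' t a)
      map_mul' := fun a b => Subtype.ext (map_mul (φ t) (a : B) b)
      map_add' := fun a b => Subtype.ext (map_add (φ t) (a : B) b)
      map_star' := fun a => Subtype.ext (map_star (φ t) (a : B))
      map_smul' := fun c a => Subtype.ext (map_smul (φ t) c (a : B)) },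
    fun a => Subtype.ext (φ_zero a), fun s t a => Subtype.ext (φ_add s t a),
    fun a => Continuous.subtype_mk (hcont a a.2) _⟩, fun t a => rfl⟩

namespace BratteliDiagram

variable {Br : BratteliDiagram}

set_option maxHeartbeats 400000 in
theorem existsUnique_gaugeAction (F : Br.Potential) : ∃! α : CStarFlow Br.AF,
    ∀ (t : ℝ) (n : ℕ) (μ ν : Br.FinPath n) (h : μ.range = ν.range),
      α t (matrixUnit μ ν h)
        = Complex.exp (Complex.I * t * (μ.energy F - ν.energy F)) • matrixUnit μ ν h := by
  obtain ⟨θ, hθ⟩ := exists_phase F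
  obtain ⟨α, hα⟩ := exists_flow_of_generators
    {T | ∃ (n : ℕ) (μ ν : Br.FinPath n) (h : μ.range = ν.range), T = matrixUnitOp μ ν h}
    (fun t => (phaseUnitary fun x => t * θ x).conjStarAlgEquiv)
    (fun a => by
      ext ξ x
      change phaseMul (fun x => 0 * θ x) (a (phaseMul (fun x => -(0 * θ x)) ξ)) x = a ξ x
      simp [phaseMul_zero])
    (fun s t a => by
      ext ξ x
      change phaseMul (fun x => (s + t) * θ x) (a (phaseMul (fun x => -((s + t) * θ x)) ξ)) x
        = phaseMul (fun x => s * θ x) (phaseMul (fun x => t * θ x)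
            (a (phaseMul (fun x => -(t * θ x)) (phaseMul (fun x => -(s * θ x)) ξ)))) x
      rw [phaseMul_phaseMul, phaseMul_phaseMul]
      ring_nf)
    (by
      rintro _ ⟨n, μ, ν, h, rfl⟩
      refine ⟨μ.energy F - ν.energy F, fun t => ?_⟩
      have e := conj_matrixUnitOp F θ hθ t μ ν h
      rw [← Complex.ofReal_sub] at e
      exact e)
  have hα' : ∀ (t : ℝ) (n : ℕ) (μ ν : Br.FinPath n) (h : μ.range = ν.range),
      α t (matrixUnit μ ν h)
        = Complex.exp (Complex.I * t * (μ.energy F - ν.energy F)) • matrixUnit μ ν h := by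
    intro t n μ ν h
    exact Subtype.ext ((hα t (matrixUnit μ ν h)).trans (conj_matrixUnitOp F θ hθ t μ ν h))
  refine ⟨α, hα', fun α' h' => CStarFlow.ext fun t a => ?_⟩
  have : α' t = α t := by
    refine starAlgEquiv_ext_of_generators ?_
    rintro _ ⟨n, μ, ν, h, rfl⟩
    exact (h' t n μ ν h).trans (hα' t n μ ν h).symm
  rw [this]

/-- The generalized gauge action `α^F` on `AF(Br)`: the unique continuous one-parameter group of
automorphisms with `α_t(E_{μ,ν}) = exp (i t (F(μ) - F(ν))) E_{μ,ν}`. -/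
noncomputable def gaugeAction (F : Br.Potential) : CStarFlow Br.AF :=
  (existsUnique_gaugeAction F).choose

theorem gaugeAction_matrixUnit (F : Br.Potential) (t : ℝ) {n : ℕ} (μ ν : Br.FinPath n)
    (h : μ.range = ν.range) : gaugeAction F t (matrixUnit μ ν h)
      = Complex.exp (Complex.I * t * (μ.energy F - ν.energy F)) • matrixUnit μ ν h :=
  (existsUnique_gaugeAction F).choose_spec.1 t n μ ν h

end BratteliDiagram

/-- A flow on a unital `C*`-algebra is a generalized gauge action when it is conjugate to `α^F` on
`AF(Br)` for some Bratteli diagram `Br` and some potential `F` on it. -/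
def IsGeneralizedGaugeAction {A : Type*} [CStarAlgebra A] (α : CStarFlow A) : Prop :=
  ∃ (Br : BratteliDiagram) (F : Br.Potential) (φ : A ≃⋆ₐ[ℂ] Br.AF),
    ∀ t a, φ (α t a) = BratteliDiagram.gaugeAction F t (φ a)

/-! The product diagram has pairs of arrows of equal level as its arrows, so its paths are pairs of
paths of equal length. The vectors `δ_x ⊗ δ_y` form an orthonormal basis of `ℓ²(X) ⊗ ℓ²(Y)` indexed
by the infinite paths of the product, and the resulting unitary carries `E_{μ,ν} ⊗ E_{κ,l}` to the
matrix unit of the paired paths (`conj_opTensor_matrixUnitOp`). Hence the spatial tensor product is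
the AF-algebra of the product diagram (`tensorEquivAF`), and the wanted flow is the gauge action of
the potential `F(a) - F'(b)` transported along this isomorphism. Uniqueness is density of the span
of elementary tensors.

For KMS states, matrix units are eigenvectors of the flows and span densely. On eigenvectors `α_t(a)
= exp(ict) a` the KMS condition becomes the twisted trace relation `ω(ab) = exp(-βc) ω(ba)`, and
that relation on a densely spanning set implies the full condition (`kmsStates_apply_mul`,
`mem_kmsStates_of_eigenvectors`).

The heart is the factorization `Ω(a ⊗ b) = Ω(a ⊗ 1) ω'(b)` for `Ω ∈ S^α_β`
(`IsTensorFlow.apply_eq_mul`). For an off-diagonal matrix unit `a` both sides vanish. For a diagonal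
one, `b ↦ Ω(a ⊗ b)` is positive of mass at most one and satisfies the `(-β)`-KMS relation; adding
the missing multiple of `ω'` gives a `(-β)`-KMS state, which is `ω'` by uniqueness. So the
restriction `Ω ↦ Ω(· ⊗ 1)` is injective. It is onto because product states exist, and it is
continuous from a compact to a Hausdorff space, hence a homeomorphism; its inverse is the required
map.

The product state is constructed directly (`exists_isState_elemTensor`). A KMS state vanishes at
off-diagonal matrix units, so it is a pointwise limit of convex combinations of vector states at
basis vectors. Vector states at `δ_x` and `δ_y` have the vector state at `δ_x ⊗ δ_y` as their
product, and weak* compactness of the state space supplies the limit on the tensor product. -/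

/-! ### States: norm bound and weak* compactness -/

section StateBounds

variable {A : Type*} [CStarAlgebra A]

open scoped ComplexOrder ComplexConjugate

theorem IsState.map_star {ω : WeakDual ℂ A} (hω : IsState ω) (a : A) :
    ω (star a) = conj (ω a) := by
  have h0 := Complex.nonneg_iff.1 (hω.1 a)
  -- Positivity at `a + 1` forces the imaginary parts of `ω(a)` and `ω(a*)` to cancel; positivity at
  -- `a + i` forces the real parts to agree.
  have h1 := Complex.nonneg_iff.1 (hω.1 (a + 1))
  have h2 := Complex.nonneg_iff.1 (hω.1 (a + Complex.I • (1 : A)))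
  have e1 : star (a + 1) * (a + 1) = star a * a + star a + a + 1 := by
    rw [star_add, star_one]; noncomm_ring
  have e2 : star (a + Complex.I • (1 : A)) * (a + Complex.I • (1 : A))
      = star a * a + Complex.I • star a - Complex.I • a + 1 := by
    simp only [star_add, star_smul, star_one, mul_add, add_mul, smul_add, smul_mul_assoc, mul_smul_comm,
      one_mul, mul_one, smul_smul, RCLike.star_def, Complex.conj_I, neg_mul, Complex.I_mul_I,
      neg_neg, one_smul, neg_smul, smul_neg]
    abel
  rw [e1] at h1
  rw [e2] at h2
  simp only [map_add, map_sub, map_smul, hω.2, Complex.add_im, Complex.sub_im, smul_eq_mul,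
    Complex.I_mul_im, Complex.one_im] at h1 h2
  apply Complex.ext
  · simp only [Complex.conj_re]; linarith [h0.2, h2.2]
  · simp only [Complex.conj_im]; linarith [h0.2, h1.2]

/-- In the spectral order `‖a‖² - a*a` is positive, hence of the form `b*b`, where the state is
nonnegative. -/
theorem IsState.apply_star_mul_self_le {ω : WeakDual ℂ A} (hω : IsState ω) (a : A) :
    (ω (star a * a)).re ≤ ‖a‖ ^ 2 := by
  let _ := CStarAlgebra.spectralOrder A
  have _ := CStarAlgebra.spectralOrderedRing A
  have h := CStarAlgebra.star_mul_le_algebraMap_norm_sq (a := a)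
  rw [← sub_nonneg, CStarAlgebra.nonneg_iff_eq_star_mul_self] at h
  obtain ⟨b, hb⟩ := h
  have hp := (Complex.nonneg_iff.1 (hω.1 b)).1
  have e : (algebraMap ℝ A) (‖a‖ ^ 2) = ((‖a‖ ^ 2 : ℝ) : ℂ) • (1 : A) := by
    rw [Algebra.algebraMap_eq_smul_one]
    exact (Complex.coe_smul _ _).symm
  rw [← hb, e, map_sub, map_smul, hω.2, Complex.sub_re, smul_eq_mul, mul_one,
    Complex.ofReal_re] at hp
  linarith

/-- The variance of `a`, that is `ω` of `(a - ω(a))*(a - ω(a))`, equals `ω(a*a) - |ω(a)|²` and is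
nonnegative. -/
theorem IsState.norm_apply_le {ω : WeakDual ℂ A} (hω : IsState ω) (a : A) : ‖ω a‖ ≤ ‖a‖ := by
  have h := (Complex.nonneg_iff.1 (hω.1 (a - ω a • (1 : A)))).1
  have e : star (a - ω a • (1 : A)) * (a - ω a • (1 : A))
      = star a * a - ω a • star a - conj (ω a) • a + (conj (ω a) * ω a) • (1 : A) := by
    simp only [star_sub, star_smul, star_one, mul_sub, sub_mul, smul_sub, smul_mul_assoc, mul_smul_comm,
      one_mul, mul_one, smul_smul, RCLike.star_def]
    rw [mul_comm]
    abel
  rw [e] at h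
  simp only [map_add, map_sub, map_smul, hω.2, hω.map_star, smul_eq_mul, mul_one] at h
  have h2 := hω.apply_star_mul_self_le a
  have h3 : (ω a * conj (ω a)).re = ‖ω a‖ ^ 2 := by
    rw [Complex.mul_conj, Complex.normSq_eq_norm_sq, Complex.ofReal_re]
  have h4 : ‖ω a‖ ^ 2 ≤ ‖a‖ ^ 2 := by
    rw [mul_comm (conj (ω a))] at h
    simp only [Complex.add_re, Complex.sub_re, h3] at h
    linarith
  exact (sq_le_sq₀ (norm_nonneg _) (norm_nonneg _)).1 h4

theorem isCompact_setOf_isState : IsCompact {ω : WeakDual ℂ A | IsState ω} := by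
  refine WeakDual.isCompact_of_bounded_of_closed ?_ ?_
  · refine (Metric.isBounded_closedBall (x := (0 : StrongDual ℂ A)) (r := 1)).subset fun ω hω => ?_
    rw [mem_closedBall_zero_iff]
    refine ContinuousLinearMap.opNorm_le_bound _ zero_le_one fun a => ?_
    rw [one_mul]
    exact IsState.norm_apply_le (ω := StrongDual.toWeakDual ω) hω a
  · have : {ω : WeakDual ℂ A | IsState ω} = {ω | ∀ a : A, 0 ≤ ω (star a * a)} ∩ {ω | ω 1 = 1} := rfl
    rw [this]
    refine IsClosed.inter ?_ ?_
    · rw [Set.ofPred_forall]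
      exact isClosed_iInter fun a => isClosed_Ici.preimage (WeakDual.eval_continuous _)
    · exact isClosed_eq (WeakDual.eval_continuous _) continuous_const

/-- For fixed `a`, `b` and extension `f`, the KMS identity compares two evaluations, so it cuts out
a weak* closed subset of the compact state space. -/
theorem isCompact_kmsStates (α : CStarFlow A) (β : ℝ) : IsCompact (kmsStates α β) := by
  have : kmsStates α β = {ω | IsState ω} ∩
      {ω | ∀ (a b : A) (f : ℂ → A), IsEntireExtension α a f → IsAnalyticFor α b →
        ω (a * b) = ω (b * f (Complex.I * β))} := rfl
  rw [this]
  refine isCompact_setOf_isState.inter_right ?_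
  simp only [Set.ofPred_forall]
  exact isClosed_iInter fun a => isClosed_iInter fun b => isClosed_iInter fun f =>
    isClosed_iInter fun _ => isClosed_iInter fun _ =>
      isClosed_eq (WeakDual.eval_continuous _) (WeakDual.eval_continuous _)

/-- A sequence of states converges pointwise to a state along a non-principal ultrafilter. -/
theorem exists_isState_tendsto_hyperfilter (ρ : ℕ → WeakDual ℂ A) (hρ : ∀ n, IsState (ρ n)) :
    ∃ σ : WeakDual ℂ A, IsState σ ∧
      ∀ a, Filter.Tendsto (fun n => ρ n a) (Filter.hyperfilter ℕ) (nhds (σ a)) := by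
  obtain ⟨σ, hσ, h⟩ := isCompact_setOf_isState.ultrafilter_le_nhds ((Filter.hyperfilter ℕ).map ρ)
    (by
      rw [Filter.le_principal_iff]
      exact Filter.Eventually.of_forall (f := (Filter.hyperfilter ℕ : Filter ℕ)) hρ)
  exact ⟨σ, hσ, fun a => ((WeakDual.eval_continuous a).tendsto σ).comp h⟩

theorem weakDual_sum_smul_apply {ι : Type*} (s : Finset ι) (w : ι → ℂ) (ρ : ι → WeakDual ℂ A)
    (a : A) : (∑ i ∈ s, w i • ρ i) a = ∑ i ∈ s, w i * ρ i a := by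
  classical
  induction s using Finset.induction_on with
  | empty => rfl
  | insert i s hi ih =>
    rw [Finset.sum_insert hi, Finset.sum_insert hi, ← ih]
    rfl

theorem IsState.sum {ι : Type*} {s : Finset ι} {w : ι → ℂ} {ρ : ι → WeakDual ℂ A}
    (hw : ∀ i ∈ s, 0 ≤ w i) (hw1 : ∑ i ∈ s, w i = 1) (hρ : ∀ i ∈ s, IsState (ρ i)) :
    IsState (∑ i ∈ s, w i • ρ i) := by
  refine ⟨fun a => ?_, ?_⟩
  · rw [weakDual_sum_smul_apply]
    exact Finset.sum_nonneg fun i hi => mul_nonneg (hw i hi) ((hρ i hi).1 a)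
  · rw [weakDual_sum_smul_apply, ← hw1]
    exact Finset.sum_congr rfl fun i hi => by rw [(hρ i hi).2, mul_one]

end StateBounds

/-! ### The KMS condition in terms of eigenvectors of the flow -/

section Eigenvectors

variable {A : Type*} [CStarAlgebra A]

/-- `a` spans a one-dimensional invariant subspace on which the flow acts as `exp (i c t)`. -/
def CStarFlow.IsEigenvector (α : CStarFlow A) (c : ℝ) (a : A) : Prop :=
  ∀ t : ℝ, α t a = Complex.exp (Complex.I * t * c) • a

theorem CStarFlow.IsEigenvector.isEntireExtension {α : CStarFlow A} {c : ℝ} {a : A}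
    (h : α.IsEigenvector c a) :
    IsEntireExtension α a fun z => Complex.exp (Complex.I * z * c) • a :=
  ⟨by fun_prop, fun t => (h t).symm⟩

/-- Two continuous functionals that agree on a set with dense span are equal. -/
theorem weakDual_ext_of_dense_span {S : Set A} (hS : Dense (Submodule.span ℂ S : Set A))
    {ω ρ : WeakDual ℂ A} (h : ∀ a ∈ S, ω a = ρ a) : ω = ρ :=
  ContinuousLinearMap.ext_on (f := WeakDual.toStrongDual ω) (g := WeakDual.toStrongDual ρ) hS h

theorem continuousLinearMap_eq_of_dense_span {E : Type*} [NormedAddCommGroup E] [NormedSpace ℂ E]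
    {S : Set A} (hS : Dense (Submodule.span ℂ S : Set A)) (f g : A →L[ℂ] E)
    (h : ∀ a ∈ S, f a = g a) (a : A) : f a = g a :=
  DFunLike.congr_fun (ContinuousLinearMap.ext_on (f := f) (g := g) hS h) a

/-- An automorphism of a flow, as a bounded operator. -/
noncomputable def CStarFlow.toCLM (α : CStarFlow A) (t : ℝ) : A →L[ℂ] A :=
  ⟨(α t : A →ₐ[ℂ] A).toLinearMap, (StarAlgEquiv.isometry (α t)).continuous⟩

/-- The entire extension at `iβ` multiplies `a` by `exp(i · iβ · c) = exp(-βc)`. This gives the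
relation for eigenvectors `b`, and continuity gives it for every `b`, analytic or not. -/
theorem kmsStates_apply_mul {α : CStarFlow A} {β : ℝ} {ω : WeakDual ℂ A} (hω : ω ∈ kmsStates α β)
    {S : Set A} (hS : Dense (Submodule.span ℂ S : Set A)) (hα : ∀ a ∈ S, ∃ c, α.IsEigenvector c a)
    {c : ℝ} {a : A} (ha : α.IsEigenvector c a) (b : A) :
    ω (a * b) = Complex.exp (-(β * c)) * ω (b * a) := by
  refine continuousLinearMap_eq_of_dense_span hS
    ((WeakDual.toStrongDual ω).comp (ContinuousLinearMap.mul ℂ A a))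
    (Complex.exp (-(β * c)) • (WeakDual.toStrongDual ω).comp ((ContinuousLinearMap.mul ℂ A).flip a))
    (fun x hx => ?_) b
  obtain ⟨d, hd⟩ := hα x hx
  change ω (a * x) = Complex.exp (-(β * c)) * ω (x * a)
  rw [hω.2 a x _ ha.isEntireExtension ⟨_, hd.isEntireExtension⟩, mul_smul_comm, map_smul,
    smul_eq_mul]
  congr 2
  linear_combination (β * c : ℂ) * Complex.I_mul_I

/-- The eigenvector relation is assumed for `a ∈ S` only, while the KMS condition concerns all
analytic elements. By density the second factor can be taken to be an eigenvector `x` in `S`; the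
relation for `x` exchanges the factors, and analytic continuation of `z ↦ ω(f(z) x)` produces the
opposite exponential. -/
theorem mem_kmsStates_of_eigenvectors {α : CStarFlow A} {β : ℝ} {ω : WeakDual ℂ A}
    (hω : IsState ω) {S : Set A} (hS : Dense (Submodule.span ℂ S : Set A))
    (h : ∀ a ∈ S, ∃ c : ℝ, α.IsEigenvector c a ∧
      ∀ b, ω (a * b) = Complex.exp (-(β * c)) * ω (b * a)) : ω ∈ kmsStates α β := by
  refine ⟨hω, fun a b f hf _ => ?_⟩
  refine continuousLinearMap_eq_of_dense_span hS
    ((WeakDual.toStrongDual ω).comp (ContinuousLinearMap.mul ℂ A a))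
    ((WeakDual.toStrongDual ω).comp ((ContinuousLinearMap.mul ℂ A).flip (f (Complex.I * β))))
    (fun x hx => ?_) b
  obtain ⟨c, hc, hx⟩ := h x hx
  change ω (a * x) = ω (x * f (Complex.I * β))
  rcases eq_or_ne β 0 with rfl | hβ
  -- At `β = 0` the relation says that `ω` is a trace, which does not force invariance under the
  -- flow; but then `f(iβ)` is just `a`.
  · have e : f (Complex.I * (0 : ℝ)) = a := by
      have := hf.2 0
      rw [α.map_zero] at this
      simpa using this
    rw [e, hx a]
    simp
  -- Comparing `y` with the unit gives `ω(y) = exp(-βd) ω(y)`, so `ω` kills every eigenvector in `S`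
  -- of nonzero weight `d`, and invariance follows.
  have hinv : ∀ (t : ℝ) (y : A), ω (α t y) = ω y := by
    intro t y
    refine continuousLinearMap_eq_of_dense_span hS
      ((WeakDual.toStrongDual ω).comp (α.toCLM t)) (WeakDual.toStrongDual ω) (fun y hy => ?_) y
    obtain ⟨d, hd, hy⟩ := h y hy
    change ω (α t y) = ω y
    rw [hd t, map_smul]
    rcases eq_or_ne d 0 with rfl | hd0
    · simp
    have h1 := hy 1
    rw [mul_one, one_mul] at h1
    have : ω y = 0 := by
      by_contra hne
      have h2 : Complex.exp (-(β * d)) = 1 := mul_right_cancel₀ hne (by rw [one_mul]; exact h1.symm)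
      have h3 : Real.exp (-(β * d)) = 1 := by exact_mod_cast h2
      rw [Real.exp_eq_one_iff] at h3
      have : β * d = 0 := by linarith
      exact (mul_ne_zero hβ hd0) this
    rw [this, smul_zero]
  have hg : ∀ z : ℂ, ω (f z * x) = Complex.exp (-(Complex.I * z * c)) * ω (a * x) := by
    have d1 : Differentiable ℂ fun z => ω (f z * x) :=
      ((WeakDual.toStrongDual ω).comp ((ContinuousLinearMap.mul ℂ A).flip x)).differentiable.comp
        hf.1
    have d2 : Differentiable ℂ fun z => Complex.exp (-(Complex.I * z * c)) * ω (a * x) := by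
      fun_prop
    have hr : ∀ t : ℝ, ω (f t * x) = Complex.exp (-(Complex.I * t * c)) * ω (a * x) := by
      intro t
      have e : α t (a * x) = Complex.exp (Complex.I * t * c) • (f t * x) := by
        rw [_root_.map_mul, hc t, hf.2 t, mul_smul_comm]
      rw [← hinv t (a * x), e, map_smul, smul_eq_mul, ← mul_assoc, ← Complex.exp_add,
        neg_add_cancel, Complex.exp_zero, one_mul]
    have a1 : AnalyticOnNhd ℂ (fun z => ω (f z * x)) Set.univ := fun z _ => d1.analyticAt z
    have a2 : AnalyticOnNhd ℂ (fun z => Complex.exp (-(Complex.I * z * c)) * ω (a * x)) Set.univ :=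
      fun z _ => d2.analyticAt z
    -- Both sides are entire and agree at real points, which accumulate at `0`; the identity theorem
    -- applies.
    refine congrFun (a1.eq_of_frequently_eq (z₀ := 0) a2 ?_)
    have ht : Filter.Tendsto (fun t : ℝ => (t : ℂ)) (nhdsWithin 0 {0}ᶜ) (nhdsWithin 0 {0}ᶜ) := by
      refine tendsto_nhdsWithin_of_tendsto_nhds_of_eventually_within _ ?_ ?_
      · exact (Complex.continuous_ofReal.tendsto' 0 0 Complex.ofReal_zero).mono_left
          nhdsWithin_le_nhds
      · filter_upwards [self_mem_nhdsWithin] with t ht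
        simpa using ht
    exact ht.frequently (Filter.Frequently.of_forall hr)
  rw [hx, hg, ← mul_assoc, ← Complex.exp_add]
  have : -(β * c : ℂ) + -(Complex.I * (Complex.I * β) * c) = 0 := by
    linear_combination (-(β * c : ℂ)) * Complex.I_mul_I
  rw [this, Complex.exp_zero, one_mul]

end Eigenvectors

/-! ### Adjoints of partial bijections and closed linear spans -/

section PartialBijections

variable {X : Type*} [DecidableEq X]

/-- Composing functions with `f` moves basis vectors along the inverse of `f`; this is what
identifies the adjoint. -/
theorem pequivOp_single (f : X ≃. X) (x : X) :
    pequivOp f (lp.single 2 x (1 : ℂ)) = (f.symm x).elim 0 fun y => lp.single 2 y (1 : ℂ) := by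
  ext z
  rw [pequivOp_apply]
  rcases hz : f z with _ | w
  · rcases hx : f.symm x with _ | y
    · rfl
    · have : f y = some x := f.eq_some_iff.1 hx
      have hne : z ≠ y := by rintro rfl; simp [this] at hz
      simp [lp.single_apply, hne]
  · by_cases hwx : w = x
    · subst hwx
      have : f.symm w = some z := f.eq_some_iff.2 hz
      simp [this]
    · rcases hx : f.symm x with _ | y
      · simp [lp.single_apply, hwx]
      · have hy : f y = some x := f.eq_some_iff.1 hx
        have hne : z ≠ y := by
          rintro rfl
          rw [hz, Option.some_inj] at hy
          exact hwx hy
        simp [lp.single_apply, hne, hwx]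

theorem inner_single_one (x : X) (ξ : ℓ²(X, ℂ)) : inner ℂ (lp.single 2 x (1 : ℂ)) ξ = ξ x := by
  rw [lp.inner_single_left]
  simp

theorem star_pequivOp (f : X ≃. X) : star (pequivOp f) = pequivOp f.symm := by
  ext ξ x
  rw [← inner_single_one x, ContinuousLinearMap.star_eq_adjoint,
    ContinuousLinearMap.adjoint_inner_right, pequivOp_single, pequivOp_apply]
  rcases f.symm x with _ | y
  · exact inner_zero_left _
  · exact inner_single_one y ξ

end PartialBijections

theorem coe_cstarGenerated_eq_closure_span {B : Type*} [CStarAlgebra B] {G M : Set B}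
    (hM : M ⊆ cstarGenerated G)
    (hG : (StarAlgebra.adjoin ℂ G : Set B) ⊆ closure (Submodule.span ℂ M : Set B)) :
    (cstarGenerated G : Set B) = closure (Submodule.span ℂ M : Set B) := by
  refine Set.Subset.antisymm (closure_minimal hG isClosed_closure) ?_
  refine closure_minimal (fun x hx => ?_) (cstarGenerated_isClosed G)
  exact Submodule.span_le (p := Subalgebra.toSubmodule (cstarGenerated G).toSubalgebra).2 hM hx

/-- The subalgebra has the induced topology, so closures can be computed in the ambient algebra
after applying the inclusion. -/
theorem dense_span_of_coe_eq_closure {B : Type*} [CStarAlgebra B] {A : StarSubalgebra ℂ B}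
    {M : Set B} (hA : (A : Set B) = closure (Submodule.span ℂ M : Set B)) :
    Dense (Submodule.span ℂ {x : A | (x : B) ∈ M} : Set A) := by
  have hM : M ⊆ A := by rw [hA]; exact Submodule.subset_span.trans subset_closure
  intro x
  rw [Topology.IsInducing.subtypeVal.closure_eq_preimage_closure_image]
  change (x : B) ∈ closure ((Subalgebra.toSubmodule A.toSubalgebra).subtype ''
    (Submodule.span ℂ {x : A | (x : B) ∈ M}))
  rw [← Submodule.map_coe, Submodule.map_span]
  have : (Subalgebra.toSubmodule A.toSubalgebra).subtype '' {x : A | (x : B) ∈ M} = M := by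
    ext m
    exact ⟨by rintro ⟨y, hy, rfl⟩; exact hy, fun hm => ⟨⟨m, hM hm⟩, hm, rfl⟩⟩
  rw [this, ← hA]
  exact x.2

/-! ### Matrix units: relations, refinement to higher levels, density -/

namespace BratteliDiagram

variable {Br : BratteliDiagram}

/-- Each level is finite and each vertex emits finitely many arrows. This makes the sums over all
paths of a given length finite. -/
instance finite_arrow (n : ℕ) : Finite (Br.Arrow n) := by
  have := Br.finite_vertex n
  have h : (⋃ v, {a : Br.Arrow n | Br.src a = v}).Finite :=
    Set.finite_iUnion fun v => Br.finite_emitted v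
  refine Set.finite_univ_iff.1 (h.subset fun a _ => ?_)
  simp

instance finite_finPath (n : ℕ) : Finite (Br.FinPath n) := by
  refine Finite.of_injective (fun (μ : Br.FinPath n) (i : Fin n) => μ.arrow i i.2) fun μ ν h => ?_
  ext i hi
  exact congrFun h ⟨i, hi⟩

noncomputable instance fintypeFinPath (n : ℕ) : Fintype (Br.FinPath n) := Fintype.ofFinite _

/-- The finite path formed by the first `n` arrows of an infinite path. -/
def InfPath.take (x : Br.InfPath) (n : ℕ) : Br.FinPath n where
  arrow i _ := x.arrow i
  comp i _ := x.comp i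

theorem InfPath.startsWith_iff {x : Br.InfPath} {n : ℕ} {μ : Br.FinPath n} :
    x.StartsWith μ ↔ x.take n = μ :=
  ⟨fun h => by ext i hi; exact h i hi, by rintro rfl i hi; rfl⟩

theorem InfPath.startsWith_take (x : Br.InfPath) (n : ℕ) : x.StartsWith (x.take n) :=
  fun _ _ => rfl

theorem InfPath.range_take (x : Br.InfPath) (n : ℕ) : (x.take n).range = Br.src (x.arrow n) :=
  (x.startsWith_take n).range_eq

open Classical in
theorem FinPath.exists_startsWith {n : ℕ} (μ : Br.FinPath n) :
    ∃ x : Br.InfPath, x.StartsWith μ := by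
  let f : ∀ i, Br.Arrow i := fun i => Nat.rec
    (if h : 0 < n then μ.arrow 0 h else (Br.no_sinks Br.top).choose)
    (fun i a => if h : i + 1 < n then μ.arrow (i + 1) h else (Br.no_sinks (Br.rng a)).choose) i
  have hs : ∀ i, f (i + 1) = if h : i + 1 < n then μ.arrow (i + 1) h
      else (Br.no_sinks (Br.rng (f i))).choose := fun i => rfl
  have hf : ∀ i (h : i < n), f i = μ.arrow i h := by
    intro i h
    cases i with
    | zero => exact dif_pos h
    | succ i => rw [hs, dif_pos h]
  refine ⟨⟨f, fun i => ?_⟩, hf⟩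
  by_cases h : i + 1 < n
  · rw [hf i (by omega), hf (i + 1) h]
    exact μ.comp i h
  · rw [hs, dif_neg h]
    exact (Br.no_sinks (Br.rng (f i))).choose_spec.symm

/-- A choice of an infinite path that begins with a given finite path. -/
noncomputable def FinPath.extend {n : ℕ} (μ : Br.FinPath n) : Br.InfPath :=
  μ.exists_startsWith.choose

theorem FinPath.extend_startsWith {n : ℕ} (μ : Br.FinPath n) : μ.extend.StartsWith μ :=
  μ.exists_startsWith.choose_spec

theorem InfPath.replace_arrow {n : ℕ} (x : Br.InfPath) (ν : Br.FinPath n)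
    (h : ν.range = Br.src (x.arrow n)) (i : ℕ) :
    (x.replace ν h).arrow i = if hi : i < n then ν.arrow i hi else x.arrow i := by
  simp [InfPath.replace]

theorem InfPath.StartsWith.replace_eq {n : ℕ} {x : Br.InfPath} {μ : Br.FinPath n}
    (hx : x.StartsWith μ) (h : μ.range = Br.src (x.arrow n)) : x.replace μ h = x := by
  ext i
  rw [replace_arrow]
  split_ifs with hi
  · exact (hx i hi).symm
  · rfl

open Classical in
theorem matrixUnitOp_apply {n : ℕ} (μ ν : Br.FinPath n) (h : μ.range = ν.range)
    (ξ : ℓ²(Br.InfPath, ℂ)) (x : Br.InfPath) :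
    matrixUnitOp μ ν h ξ x
      = if hx : x.StartsWith μ then ξ (x.replace ν (h ▸ hx.range_eq)) else 0 := by
  change (swapPrefix μ ν h x).elim 0 ξ = _
  by_cases hx : x.StartsWith μ
  · have e : swapPrefix μ ν h x = some (x.replace ν (h ▸ hx.range_eq)) := dif_pos hx
    rw [e, dif_pos hx]
    rfl
  · have e : swapPrefix μ ν h x = none := dif_neg hx
    rw [e, dif_neg hx]
    rfl

theorem star_matrixUnitOp {n : ℕ} (μ ν : Br.FinPath n) (h : μ.range = ν.range) :
    star (matrixUnitOp μ ν h) = matrixUnitOp ν μ h.symm := by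
  classical
  exact star_pequivOp (swapPrefix μ ν h)

theorem matrixUnitOp_mul_matrixUnitOp {n : ℕ} (μ ν κ : Br.FinPath n) (h : μ.range = ν.range)
    (h' : ν.range = κ.range) :
    matrixUnitOp μ ν h * matrixUnitOp ν κ h' = matrixUnitOp μ κ (h.trans h') := by
  ext ξ x
  change matrixUnitOp μ ν h (matrixUnitOp ν κ h' ξ) x = _
  rw [matrixUnitOp_apply, matrixUnitOp_apply]
  split_ifs with hx
  · rw [matrixUnitOp_apply, dif_pos (x.replace_startsWith ν _)]
    refine congrArg (ξ : Br.InfPath → ℂ) (InfPath.ext (funext fun i => ?_))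
    simp only [InfPath.replace_arrow]
    split_ifs <;> rfl
  · rfl

theorem matrixUnitOp_mul_of_ne {n : ℕ} {μ ν κ l : Br.FinPath n} (h : μ.range = ν.range)
    (h' : κ.range = l.range) (hne : ν ≠ κ) : matrixUnitOp μ ν h * matrixUnitOp κ l h' = 0 := by
  ext ξ x
  change matrixUnitOp μ ν h (matrixUnitOp κ l h' ξ) x = 0
  rw [matrixUnitOp_apply]
  split_ifs with hx
  · rw [matrixUnitOp_apply, dif_neg]
    intro hc
    exact hne ((InfPath.startsWith_iff.1 (x.replace_startsWith ν _)).symm.trans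
      (InfPath.startsWith_iff.1 hc))
  · rfl

open Classical in
/-- A matrix unit of level `n` is a sum of matrix units of any level `N ≥ n`. -/
theorem matrixUnitOp_eq_sum {n N : ℕ} (hN : n ≤ N) (μ ν : Br.FinPath n) (h : μ.range = ν.range) :
    matrixUnitOp μ ν h = ∑ κ : Br.FinPath N, if hκ : κ.extend.StartsWith ν then
      matrixUnitOp ((κ.extend.replace μ (h ▸ hκ.range_eq)).take N) κ (by
        rw [InfPath.range_take, InfPath.replace_tail _ _ _ _ hN, κ.extend_startsWith.range_eq])
      else 0 := by
  ext ξ x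
  rw [matrixUnitOp_apply, sum_apply, lp.coeFn_sum, Finset.sum_apply]
  split_ifs with hx
  -- Here `y` is the path at which the left side reads `ξ`. Only the summand at the first `N` arrows
  -- of `y` survives: the tail of `κ` beyond `n` must be that of `x`, and its beginning is `ν`.
  -- Testing `κ.extend` instead of `κ` is harmless because `n ≤ N`.
  · set y := x.replace ν (h ▸ hx.range_eq) with hy
    have hyN : ∀ i, n ≤ i → y.arrow i = x.arrow i := x.replace_tail ν _
    have hyn : y.StartsWith ν := x.replace_startsWith ν _
    have hk : ∀ i, i < N → (y.take N).extend.arrow i = y.arrow i :=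
      fun i hi => (y.take N).extend_startsWith i hi
    have hk' : (y.take N).extend.StartsWith ν := fun i hi => (hk i (by omega)).trans (hyn i hi)
    rw [Finset.sum_eq_single (y.take N)]
    · rw [dif_pos hk', matrixUnitOp_apply, dif_pos]
      · refine congrArg (ξ : Br.InfPath → ℂ) (InfPath.ext (funext fun i => ?_))
        rw [x.replace_arrow (y.take N)]
        split_ifs with hi
        · rfl
        · exact hyN i (by omega)
      · intro i hi
        change x.arrow i = ((y.take N).extend.replace μ (h ▸ hk'.range_eq)).arrow i
        rw [InfPath.replace_arrow]
        split_ifs with hin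
        · exact hx i hin
        · rw [hk i hi, hyN i (by omega)]
    · intro κ _ hne
      split_ifs with hκ
      · rw [matrixUnitOp_apply, dif_neg]
        intro hc
        refine hne ?_
        ext i hi
        rw [← κ.extend_startsWith i hi]
        change _ = y.arrow i
        by_cases hin : i < n
        · rw [hκ i hin, hyn i hin]
        · have := hc i hi
          rw [hyN i (by omega), this]
          exact (κ.extend.replace_tail μ (h ▸ hκ.range_eq) i (by omega)).symm
      · rfl
    · intro hc
      exact absurd (Finset.mem_univ _) hc
  · refine (Finset.sum_eq_zero fun κ _ => ?_).symm
    split_ifs with hκ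
    · rw [matrixUnitOp_apply, dif_neg]
      intro hc
      refine hx fun i hi => ?_
      rw [hc i (by omega)]
      exact (κ.extend.replace_startsWith μ (h ▸ hκ.range_eq)) i hi
    · rfl

variable (Br) in
/-- The linear span of the matrix units of level `n`. -/
noncomputable def levelSpan (n : ℕ) : Submodule ℂ (ℓ²(Br.InfPath, ℂ) →L[ℂ] ℓ²(Br.InfPath, ℂ)) :=
  Submodule.span ℂ {T | ∃ (μ ν : Br.FinPath n) (h : μ.range = ν.range), T = matrixUnitOp μ ν h}

theorem matrixUnitOp_mem_levelSpan {n N : ℕ} (hN : n ≤ N) (μ ν : Br.FinPath n)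
    (h : μ.range = ν.range) : matrixUnitOp μ ν h ∈ Br.levelSpan N := by
  classical
  rw [matrixUnitOp_eq_sum hN]
  refine Submodule.sum_mem _ fun κ _ => ?_
  split_ifs with hκ
  · exact Submodule.subset_span ⟨_, _, _, rfl⟩
  · exact Submodule.zero_mem _

theorem mul_mem_levelSpan {n : ℕ} {S T : ℓ²(Br.InfPath, ℂ) →L[ℂ] ℓ²(Br.InfPath, ℂ)}
    (hS : S ∈ Br.levelSpan n) (hT : T ∈ Br.levelSpan n) : S * T ∈ Br.levelSpan n := by
  refine Submodule.span_induction₂ (p := fun S T _ _ => S * T ∈ Br.levelSpan n)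
    ?_ ?_ ?_ ?_ ?_ ?_ ?_ hS hT
  · rintro _ _ ⟨μ, ν, h, rfl⟩ ⟨κ, l, h', rfl⟩
    by_cases hne : ν = κ
    · subst hne
      rw [matrixUnitOp_mul_matrixUnitOp]
      exact Submodule.subset_span ⟨_, _, _, rfl⟩
    · rw [matrixUnitOp_mul_of_ne h h' hne]
      exact Submodule.zero_mem _
  · intro y _; rw [zero_mul]; exact Submodule.zero_mem _
  · intro y _; rw [mul_zero]; exact Submodule.zero_mem _
  · intro x y z _ _ _ h1 h2; rw [add_mul]; exact Submodule.add_mem _ h1 h2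
  · intro x y z _ _ _ h1 h2; rw [mul_add]; exact Submodule.add_mem _ h1 h2
  · intro r x y _ _ h; rw [smul_mul_assoc]; exact Submodule.smul_mem _ _ h
  · intro r x y _ _ h; rw [mul_smul_comm]; exact Submodule.smul_mem _ _ h

variable (Br) in
/-- The set of all matrix units of a Bratteli diagram. -/
def matrixUnitOps : Set (ℓ²(Br.InfPath, ℂ) →L[ℂ] ℓ²(Br.InfPath, ℂ)) :=
  {T | ∃ (n : ℕ) (μ ν : Br.FinPath n) (h : μ.range = ν.range), T = matrixUnitOp μ ν h}

theorem levelSpan_le (n : ℕ) : Br.levelSpan n ≤ Submodule.span ℂ Br.matrixUnitOps :=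
  Submodule.span_mono fun _ ⟨μ, ν, h, e⟩ => ⟨n, μ, ν, h, e⟩

theorem one_eq_matrixUnitOp (μ : Br.FinPath 0) :
    (1 : ℓ²(Br.InfPath, ℂ) →L[ℂ] ℓ²(Br.InfPath, ℂ)) = matrixUnitOp μ μ rfl := by
  ext ξ x
  have hx : x.StartsWith μ := fun i hi => absurd hi (by omega)
  rw [matrixUnitOp_apply, dif_pos hx, hx.replace_eq]
  rfl

/-- The span is already a `*`-algebra: two matrix units of different levels are both expanded at the
larger level, where products of matrix units are matrix units or zero. -/
theorem adjoin_matrixUnitOps_le :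
    (StarAlgebra.adjoin ℂ Br.matrixUnitOps : Set (ℓ²(Br.InfPath, ℂ) →L[ℂ] ℓ²(Br.InfPath, ℂ)))
      ⊆ Submodule.span ℂ Br.matrixUnitOps := by
  intro a ha
  induction ha using StarAlgebra.adjoin_induction with
  | mem g hg => exact Submodule.subset_span hg
  | algebraMap r =>
    rw [Algebra.algebraMap_eq_smul_one, one_eq_matrixUnitOp ⟨fun _ h => absurd h (by omega),
      fun _ h => absurd h (by omega)⟩]
    exact Submodule.smul_mem _ _ (Submodule.subset_span ⟨_, _, _, _, rfl⟩)
  | add x y _ _ hx hy => exact Submodule.add_mem _ hx hy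
  | mul x y _ _ hx hy =>
    refine Submodule.span_induction₂
      (p := fun S T _ _ => S * T ∈ Submodule.span ℂ Br.matrixUnitOps) ?_ ?_ ?_ ?_ ?_ ?_ ?_ hx hy
    · rintro _ _ ⟨n, μ, ν, h, rfl⟩ ⟨m, κ, l, h', rfl⟩
      exact levelSpan_le _ (mul_mem_levelSpan
        (matrixUnitOp_mem_levelSpan (le_max_left n m) μ ν h)
        (matrixUnitOp_mem_levelSpan (le_max_right n m) κ l h'))
    · intro y _; rw [zero_mul]; exact Submodule.zero_mem _
    · intro y _; rw [mul_zero]; exact Submodule.zero_mem _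
    · intro x y z _ _ _ h1 h2; rw [add_mul]; exact Submodule.add_mem _ h1 h2
    · intro x y z _ _ _ h1 h2; rw [mul_add]; exact Submodule.add_mem _ h1 h2
    · intro r x y _ _ h; rw [smul_mul_assoc]; exact Submodule.smul_mem _ _ h
    · intro r x y _ _ h; rw [mul_smul_comm]; exact Submodule.smul_mem _ _ h
  | star x hx' hx =>
    clear hx'
    induction hx using Submodule.span_induction with
    | mem x hx =>
      obtain ⟨n, μ, ν, h, rfl⟩ := hx
      rw [star_matrixUnitOp]
      exact Submodule.subset_span ⟨_, _, _, _, rfl⟩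
    | zero => rw [star_zero]; exact Submodule.zero_mem _
    | add x y _ _ hx hy => rw [star_add]; exact Submodule.add_mem _ hx hy
    | smul r x _ hx => rw [star_smul]; exact Submodule.smul_mem _ _ hx

theorem coe_AF_eq_closure : (Br.AF : Set (ℓ²(Br.InfPath, ℂ) →L[ℂ] ℓ²(Br.InfPath, ℂ)))
    = closure (Submodule.span ℂ Br.matrixUnitOps) :=
  coe_cstarGenerated_eq_closure_span (fun _ h => mem_cstarGenerated h)
    (adjoin_matrixUnitOps_le.trans subset_closure)

variable (Br) in
/-- The set of all matrix units, as elements of the AF-algebra. -/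
def matrixUnits : Set Br.AF :=
  {T | ∃ (n : ℕ) (μ ν : Br.FinPath n) (h : μ.range = ν.range), T = matrixUnit μ ν h}

theorem dense_span_matrixUnits : Dense (Submodule.span ℂ Br.matrixUnits : Set Br.AF) := by
  have : Br.matrixUnits = {x : Br.AF | (x : ℓ²(Br.InfPath, ℂ) →L[ℂ] ℓ²(Br.InfPath, ℂ))
      ∈ Br.matrixUnitOps} := by
    ext x
    constructor
    · rintro ⟨n, μ, ν, h, rfl⟩
      exact ⟨n, μ, ν, h, rfl⟩
    · rintro ⟨n, μ, ν, h, e⟩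
      exact ⟨n, μ, ν, h, Subtype.ext e⟩
  rw [this]
  exact dense_span_of_coe_eq_closure coe_AF_eq_closure

theorem gaugeAction_isEigenvector (F : Br.Potential) {n : ℕ} (μ ν : Br.FinPath n)
    (h : μ.range = ν.range) :
    (gaugeAction F).IsEigenvector (μ.energy F - ν.energy F) (matrixUnit μ ν h) := by
  intro t
  rw [gaugeAction_matrixUnit, Complex.ofReal_sub]

theorem matrixUnits_isEigenvector (F : Br.Potential) :
    ∀ a ∈ Br.matrixUnits, ∃ c, (gaugeAction F).IsEigenvector c a := by
  rintro _ ⟨n, μ, ν, h, rfl⟩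
  exact ⟨_, gaugeAction_isEigenvector F μ ν h⟩

theorem matrixUnit_mul_matrixUnit {n : ℕ} (μ ν κ : Br.FinPath n) (h : μ.range = ν.range)
    (h' : ν.range = κ.range) :
    matrixUnit μ ν h * matrixUnit ν κ h' = matrixUnit μ κ (h.trans h') :=
  Subtype.ext (matrixUnitOp_mul_matrixUnitOp μ ν κ h h')

theorem matrixUnit_mul_of_ne {n : ℕ} {μ ν κ l : Br.FinPath n} (h : μ.range = ν.range)
    (h' : κ.range = l.range) (hne : ν ≠ κ) : matrixUnit μ ν h * matrixUnit κ l h' = 0 :=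
  Subtype.ext (matrixUnitOp_mul_of_ne h h' hne)

theorem star_matrixUnit {n : ℕ} (μ ν : Br.FinPath n) (h : μ.range = ν.range) :
    star (matrixUnit μ ν h) = matrixUnit ν μ h.symm :=
  Subtype.ext (star_matrixUnitOp μ ν h)

open Classical in
theorem matrixUnit_self_eq_sum {n N : ℕ} (hN : n ≤ N) (μ : Br.FinPath n) :
    matrixUnit μ μ rfl = ∑ κ : Br.FinPath N,
      if κ.extend.StartsWith μ then matrixUnit κ κ rfl else 0 := by
  apply Subtype.ext
  rw [AddSubmonoidClass.coe_finsetSum]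
  refine (matrixUnitOp_eq_sum hN μ μ rfl).trans (Finset.sum_congr rfl fun κ _ => ?_)
  split_ifs with hκ
  · have : (κ.extend.replace μ hκ.range_eq).take N = κ := by
      rw [hκ.replace_eq]
      exact InfPath.startsWith_iff.1 κ.extend_startsWith
    simp only [this]
    rfl
  · rfl

theorem one_eq_matrixUnit (μ : Br.FinPath 0) : (1 : Br.AF) = matrixUnit μ μ rfl :=
  Subtype.ext (one_eq_matrixUnitOp μ)

/-- The projection `E_{μ,μ}` has weight zero, so it may be moved from the left of `E_{μ,ν}`, where
it acts as a unit, to the right, where it annihilates. -/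
theorem kmsStates_apply_matrixUnit_of_ne {F : Br.Potential} {β : ℝ} {ω : WeakDual ℂ Br.AF}
    (hω : ω ∈ kmsStates (gaugeAction F) β) {n : ℕ} {μ ν : Br.FinPath n} (h : μ.range = ν.range)
    (hne : μ ≠ ν) : ω (matrixUnit μ ν h) = 0 := by
  have e := kmsStates_apply_mul hω dense_span_matrixUnits (matrixUnits_isEigenvector F)
    (gaugeAction_isEigenvector F μ μ rfl) (matrixUnit μ ν h)
  rw [matrixUnit_mul_matrixUnit, matrixUnit_mul_of_ne _ _ hne.symm, map_zero, mul_zero] at e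
  exact e

end BratteliDiagram

/-! ### Algebra of elementary tensors of operators -/

section OperatorTensor

variable {H K : Type*} [NormedAddCommGroup H] [InnerProductSpace ℂ H] [CompleteSpace H]
  [NormedAddCommGroup K] [InnerProductSpace ℂ K] [CompleteSpace K]

/-- The elementary tensor `x ⊗ y` in the Hilbert space tensor product. -/
noncomputable def hilbertTmul (x : H) (y : K) : HilbertTensor H K := ((x ⊗ₜ[ℂ] y : H ⊗[ℂ] K) :)

theorem inner_hilbertTmul (x x' : H) (y y' : K) :
    inner ℂ (hilbertTmul x y) (hilbertTmul x' y') = inner ℂ x x' * inner ℂ y y' := by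
  rw [hilbertTmul, hilbertTmul, UniformSpace.Completion.inner_coe, TensorProduct.inner_tmul]

theorem opTensor_hilbertTmul (a : H →L[ℂ] H) (b : K →L[ℂ] K) (x : H) (y : K) :
    opTensor a b (hilbertTmul x y) = hilbertTmul (a x) (b y) := by
  rw [opTensor, hilbertTmul, ContinuousLinearMap.completion_apply_coe, TensorProduct.mapL_tmul]
  rfl

theorem dense_span_hilbertTmul :
    Dense (Submodule.span ℂ {v : HilbertTensor H K | ∃ x y, v = hilbertTmul x y} :
      Set (HilbertTensor H K)) := by
  refine UniformSpace.Completion.denseRange_coe.mono ?_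
  rintro _ ⟨v, rfl⟩
  change (v : HilbertTensor H K) ∈ Submodule.span ℂ {v | ∃ x y, v = hilbertTmul x y}
  induction v using TensorProduct.induction_on with
  | zero => rw [UniformSpace.Completion.coe_zero]; exact Submodule.zero_mem _
  | tmul x y => exact Submodule.subset_span ⟨x, y, rfl⟩
  | add v w hv hw => rw [UniformSpace.Completion.coe_add]; exact Submodule.add_mem _ hv hw

/-- Reduces every identity between operators on the completed tensor product to elementary tensors.
-/
theorem hilbertTensor_ext {E : Type*} [NormedAddCommGroup E] [NormedSpace ℂ E]
    {S T : HilbertTensor H K →L[ℂ] E} (h : ∀ x y, S (hilbertTmul x y) = T (hilbertTmul x y)) :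
    S = T := by
  refine ContinuousLinearMap.ext_on dense_span_hilbertTmul ?_
  rintro _ ⟨x, y, rfl⟩
  exact h x y

/-- The bounded bilinear map `(x, y) ↦ x ⊗ y` into the Hilbert space tensor product. -/
noncomputable def hilbertTmulL : H →L[ℂ] K →L[ℂ] HilbertTensor H K :=
  LinearMap.mkContinuous₂ (LinearMap.mk₂ ℂ hilbertTmul
    (fun x x' y => by
      rw [hilbertTmul, TensorProduct.add_tmul, UniformSpace.Completion.coe_add]; rfl)
    (fun c x y => by
      rw [hilbertTmul, ← TensorProduct.smul_tmul', UniformSpace.Completion.coe_smul]; rfl)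
    (fun x y y' => by
      rw [hilbertTmul, TensorProduct.tmul_add, UniformSpace.Completion.coe_add]; rfl)
    (fun c x y => by
      rw [hilbertTmul, TensorProduct.tmul_smul, UniformSpace.Completion.coe_smul]; rfl)) 1
    fun x y => by
      change ‖hilbertTmul x y‖ ≤ _
      rw [hilbertTmul, UniformSpace.Completion.norm_coe, TensorProduct.norm_tmul, one_mul]

theorem hilbertTmulL_apply (x : H) (y : K) : hilbertTmulL x y = hilbertTmul x y := rfl

theorem norm_opTensor_le (a : H →L[ℂ] H) (b : K →L[ℂ] K) : ‖opTensor a b‖ ≤ ‖a‖ * ‖b‖ := by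
  refine ContinuousLinearMap.opNorm_le_bound _ (by positivity) fun v => ?_
  induction v using UniformSpace.Completion.induction_on with
  | hp => exact isClosed_le (by fun_prop) (by fun_prop)
  | ih v =>
    rw [opTensor, ContinuousLinearMap.completion_apply_coe, UniformSpace.Completion.norm_coe,
      UniformSpace.Completion.norm_coe]
    exact ((TensorProduct.mapL a b).le_opNorm v).trans
      (mul_le_mul_of_nonneg_right (TensorProduct.norm_mapL_le a b) (norm_nonneg _))

theorem opTensor_mul (a a' : H →L[ℂ] H) (b b' : K →L[ℂ] K) :
    opTensor a b * opTensor a' b' = opTensor (a * a') (b * b') :=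
  hilbertTensor_ext fun x y => by
    change opTensor a b (opTensor a' b' _) = _
    simp only [opTensor_hilbertTmul]
    rfl

theorem opTensor_one : opTensor (1 : H →L[ℂ] H) (1 : K →L[ℂ] K) = 1 :=
  hilbertTensor_ext fun x y => by rw [opTensor_hilbertTmul]; rfl

theorem opTensor_add_left (a a' : H →L[ℂ] H) (b : K →L[ℂ] K) :
    opTensor (a + a') b = opTensor a b + opTensor a' b :=
  hilbertTensor_ext fun x y => by
    rw [add_apply]
    simp only [opTensor_hilbertTmul]
    simp only [← hilbertTmulL_apply, add_apply, map_add]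

theorem opTensor_add_right (a : H →L[ℂ] H) (b b' : K →L[ℂ] K) :
    opTensor a (b + b') = opTensor a b + opTensor a b' :=
  hilbertTensor_ext fun x y => by
    rw [add_apply]
    simp only [opTensor_hilbertTmul]
    simp only [← hilbertTmulL_apply, add_apply, map_add]

theorem opTensor_smul_left (c : ℂ) (a : H →L[ℂ] H) (b : K →L[ℂ] K) :
    opTensor (c • a) b = c • opTensor a b :=
  hilbertTensor_ext fun x y => by
    rw [smul_apply]
    simp only [opTensor_hilbertTmul]
    simp only [← hilbertTmulL_apply, smul_apply, map_smul]

theorem opTensor_smul_right (c : ℂ) (a : H →L[ℂ] H) (b : K →L[ℂ] K) :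
    opTensor a (c • b) = c • opTensor a b :=
  hilbertTensor_ext fun x y => by
    rw [smul_apply]
    simp only [opTensor_hilbertTmul]
    simp only [← hilbertTmulL_apply, smul_apply, map_smul]

theorem star_opTensor (a : H →L[ℂ] H) (b : K →L[ℂ] K) :
    star (opTensor a b) = opTensor (star a) (star b) := by
  refine hilbertTensor_ext fun x y => ?_
  refine ext_inner_left ℂ fun v => ?_
  rw [ContinuousLinearMap.star_eq_adjoint, ContinuousLinearMap.adjoint_inner_right]
  refine UniformSpace.Completion.induction_on v (isClosed_eq (by fun_prop) (by fun_prop)) fun v => ?_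
  induction v using TensorProduct.induction_on with
  | zero => simp only [UniformSpace.Completion.coe_zero, map_zero, inner_zero_left]
  | tmul x' y' =>
    change inner ℂ (opTensor a b (hilbertTmul x' y')) _ = inner ℂ (hilbertTmul x' y') _
    rw [opTensor_hilbertTmul, opTensor_hilbertTmul, inner_hilbertTmul, inner_hilbertTmul,
      ContinuousLinearMap.star_eq_adjoint, ContinuousLinearMap.star_eq_adjoint,
      ContinuousLinearMap.adjoint_inner_right, ContinuousLinearMap.adjoint_inner_right]
  | add v w hv hw => simp only [UniformSpace.Completion.coe_add, map_add, inner_add_left, hv, hw]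

variable {A : StarSubalgebra ℂ (H →L[ℂ] H)} {B : StarSubalgebra ℂ (K →L[ℂ] K)}

@[reducible] noncomputable def spatialTensorCStarAlgebra :
    CStarAlgebra (spatialTensor A B) := inferInstance

attribute [local instance] spatialTensorCStarAlgebra

@[reducible] noncomputable def spatialTensorNormedAddCommGroup :
    NormedAddCommGroup (spatialTensor A B) := inferInstance

attribute [local instance] spatialTensorNormedAddCommGroup

@[reducible] noncomputable def spatialTensorNormedSpace :
    NormedSpace ℂ (spatialTensor A B) := inferInstance

attribute [local instance] spatialTensorNormedSpace

@[reducible] noncomputable def spatialTensorModule :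
    Module ℂ (spatialTensor A B) := inferInstance

attribute [local instance] spatialTensorModule

@[reducible] noncomputable def spatialTensorTopologicalSpace :
    TopologicalSpace (spatialTensor A B) := inferInstance

attribute [local instance] spatialTensorTopologicalSpace

set_option synthInstance.maxHeartbeats 100000 in
theorem spatialTensor_continuousAdd : ContinuousAdd (spatialTensor A B) := inferInstance

attribute [local instance] spatialTensor_continuousAdd

theorem elemTensor_mul (a a' : A) (b b' : B) :
    elemTensor a b * elemTensor a' b' = elemTensor (a * a') (b * b') :=
  Subtype.ext (opTensor_mul _ _ _ _)

theorem elemTensor_one : elemTensor (1 : A) (1 : B) = 1 := Subtype.ext opTensor_one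

theorem star_elemTensor (a : A) (b : B) :
    star (elemTensor a b) = elemTensor (star a) (star b) :=
  Subtype.ext (star_opTensor _ _)

theorem elemTensor_add_left (a a' : A) (b : B) :
    elemTensor (a + a') b = elemTensor a b + elemTensor a' b :=
  Subtype.ext (opTensor_add_left _ _ _)

theorem elemTensor_add_right (a : A) (b b' : B) :
    elemTensor a (b + b') = elemTensor a b + elemTensor a b' :=
  Subtype.ext (opTensor_add_right _ _ _)

theorem elemTensor_smul_left (c : ℂ) (a : A) (b : B) :
    elemTensor (c • a) b = c • elemTensor a b :=
  Subtype.ext (opTensor_smul_left _ _ _)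

theorem elemTensor_smul_right (c : ℂ) (a : A) (b : B) :
    elemTensor a (c • b) = c • elemTensor a b :=
  Subtype.ext (opTensor_smul_right _ _ _)

theorem norm_elemTensor_le (a : A) (b : B) : ‖elemTensor a b‖ ≤ 1 * ‖a‖ * ‖b‖ := by
  rw [one_mul]
  exact norm_opTensor_le _ _

variable (A B) in
/-- The bilinear map `(a, b) ↦ a ⊗ b`. -/
noncomputable def elemTensorBilin : A →ₗ[ℂ] B →ₗ[ℂ] spatialTensor A B :=
  LinearMap.mk₂ ℂ elemTensor elemTensor_add_left elemTensor_smul_left elemTensor_add_right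
    elemTensor_smul_right

variable (A B) in
/-- The bounded bilinear map `(a, b) ↦ a ⊗ b`. -/
noncomputable def elemTensorL : A →L[ℂ] B →L[ℂ] spatialTensor A B :=
  LinearMap.mkContinuous₂ (elemTensorBilin A B) 1 norm_elemTensor_le

theorem adjoin_opTensor_le :
    (StarAlgebra.adjoin ℂ {T | ∃ a ∈ A, ∃ b ∈ B, T = opTensor a b} :
      Set (HilbertTensor H K →L[ℂ] HilbertTensor H K))
      ⊆ Submodule.span ℂ {T | ∃ a ∈ A, ∃ b ∈ B, T = opTensor a b} := by
  intro x hx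
  induction hx using StarAlgebra.adjoin_induction with
  | mem g hg => exact Submodule.subset_span hg
  | algebraMap r =>
    rw [Algebra.algebraMap_eq_smul_one, ← opTensor_one]
    exact Submodule.smul_mem _ _ (Submodule.subset_span ⟨1, one_mem _, 1, one_mem _, rfl⟩)
  | add x y _ _ hx hy => exact Submodule.add_mem _ hx hy
  | mul x y _ _ hx hy =>
    have := Submodule.mul_mem_mul hx hy
    rw [Submodule.span_mul_span] at this
    refine Submodule.span_mono ?_ this
    rintro _ ⟨_, ⟨a, ha, b, hb, rfl⟩, _, ⟨a', ha', b', hb', rfl⟩, rfl⟩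
    exact ⟨_, mul_mem ha ha', _, mul_mem hb hb', opTensor_mul _ _ _ _⟩
  | star x hx' hx =>
    clear hx'
    induction hx using Submodule.span_induction with
    | mem x hx =>
      obtain ⟨a, ha, b, hb, rfl⟩ := hx
      rw [star_opTensor]
      exact Submodule.subset_span ⟨_, star_mem ha, _, star_mem hb, rfl⟩
    | zero => rw [star_zero]; exact Submodule.zero_mem _
    | add x y _ _ hx hy => rw [star_add]; exact Submodule.add_mem _ hx hy
    | smul r x _ hx => rw [star_smul]; exact Submodule.smul_mem _ _ hx

theorem dense_span_elemTensor :
    Dense (Submodule.span ℂ {T : spatialTensor A B | ∃ a b, T = elemTensor a b} :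
      Set (spatialTensor A B)) := by
  have : {T : spatialTensor A B | ∃ a b, T = elemTensor a b} =
      {T : spatialTensor A B | (T : HilbertTensor H K →L[ℂ] HilbertTensor H K)
        ∈ {T | ∃ a ∈ A, ∃ b ∈ B, T = opTensor a b}} := by
    ext T
    constructor
    · rintro ⟨a, b, rfl⟩
      exact ⟨a, a.2, b, b.2, rfl⟩
    · rintro ⟨a, ha, b, hb, e⟩
      exact ⟨⟨a, ha⟩, ⟨b, hb⟩, Subtype.ext e⟩
  rw [this]
  exact dense_span_of_coe_eq_closure (coe_cstarGenerated_eq_closure_span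
    (fun _ h => mem_cstarGenerated h) (adjoin_opTensor_le.trans subset_closure))

end OperatorTensor

/-! ### Density arguments for bilinear maps, level by level -/

theorem continuousLinearMap_mem_of_dense_span {E E' : Type*} [NormedAddCommGroup E]
    [NormedSpace ℂ E] [NormedAddCommGroup E'] [NormedSpace ℂ E'] {S : Set E}
    (hS : Dense (Submodule.span ℂ S : Set E)) (f : E →L[ℂ] E') {W : Submodule ℂ E'}
    (hW : IsClosed (W : Set E')) (h : ∀ a ∈ S, f a ∈ W) (a : E) : f a ∈ W := by
  have h1 : Submodule.span ℂ S ≤ W.comap (f : E →ₗ[ℂ] E') := Submodule.span_le.2 h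
  exact closure_minimal (s := (Submodule.span ℂ S : Set E)) (t := f ⁻¹' W) h1
    (hW.preimage f.continuous) (hS a)

/-- Generators of unequal levels `n` and `m` are both rewritten at level `max n m`, so only pairs of
equal level have to be tested. These are exactly the pairs that the product diagram provides. -/
theorem continuousLinearMap₂_mem_of_dense_span {E₁ E₂ E : Type*} [NormedAddCommGroup E₁]
    [NormedSpace ℂ E₁] [NormedAddCommGroup E₂] [NormedSpace ℂ E₂] [NormedAddCommGroup E]
    [NormedSpace ℂ E] {S : ℕ → Set E₁} {S' : ℕ → Set E₂}
    (hS : ∀ n N, n ≤ N → S n ⊆ Submodule.span ℂ (S N))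
    (hS' : ∀ n N, n ≤ N → S' n ⊆ Submodule.span ℂ (S' N))
    (hd : Dense (Submodule.span ℂ (⋃ n, S n) : Set E₁))
    (hd' : Dense (Submodule.span ℂ (⋃ n, S' n) : Set E₂))
    (f : E₁ →L[ℂ] E₂ →L[ℂ] E) {W : Submodule ℂ E} (hW : IsClosed (W : Set E))
    (h : ∀ n, ∀ a ∈ S n, ∀ b ∈ S' n, f a b ∈ W) (a : E₁) (b : E₂) : f a b ∈ W := by
  refine continuousLinearMap_mem_of_dense_span hd' (f a) hW (fun b hb => ?_) b
  refine continuousLinearMap_mem_of_dense_span hd (f.flip b) hW (fun a ha => ?_) a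
  obtain ⟨n, ha⟩ := Set.mem_iUnion.1 ha
  obtain ⟨m, hb⟩ := Set.mem_iUnion.1 hb
  change f a b ∈ W
  refine Submodule.span_induction₂ (p := fun a b _ _ => f a b ∈ W) ?_ ?_ ?_ ?_ ?_ ?_ ?_
    (hS n _ (le_max_left n m) ha) (hS' m _ (le_max_right n m) hb)
  · exact fun a b ha hb => h _ a ha b hb
  · intro y _; rw [map_zero]; exact W.zero_mem
  · intro y _; rw [map_zero]; exact W.zero_mem
  · intro x y z _ _ _ h1 h2; rw [map_add]; exact W.add_mem h1 h2
  · intro x y z _ _ _ h1 h2; rw [map_add]; exact W.add_mem h1 h2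
  · intro r x y _ _ h; rw [map_smul]; exact W.smul_mem _ h
  · intro r x y _ _ h; rw [map_smul]; exact W.smul_mem _ h

theorem dense_span_of_subset_closure {E : Type*} [NormedAddCommGroup E] [NormedSpace ℂ E]
    {S T : Set E} (hS : Dense (Submodule.span ℂ S : Set E))
    (h : S ⊆ closure (Submodule.span ℂ T : Set E)) : Dense (Submodule.span ℂ T : Set E) := fun x =>
  continuousLinearMap_mem_of_dense_span hS (ContinuousLinearMap.id ℂ E)
    (Submodule.isClosed_topologicalClosure (Submodule.span ℂ T)) h x

namespace BratteliDiagram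

variable {Br Br' : BratteliDiagram}

attribute [local instance] spatialTensorCStarAlgebra spatialTensorNormedAddCommGroup
  spatialTensorNormedSpace spatialTensorModule spatialTensorTopologicalSpace
  spatialTensor_continuousAdd

/-- The inclusion into the bounded operators is injective, so membership in the span of operators
pulls back to the AF-algebra. -/
theorem matrixUnit_mem_span_level {n N : ℕ} (hN : n ≤ N) (μ ν : Br.FinPath n)
    (h : μ.range = ν.range) : matrixUnit μ ν h ∈ Submodule.span ℂ
      {T : Br.AF | ∃ (μ ν : Br.FinPath N) (h : μ.range = ν.range), T = matrixUnit μ ν h} := by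
  have h1 := matrixUnitOp_mem_levelSpan hN μ ν h
  have h2 : Br.levelSpan N = (Submodule.span ℂ {T : Br.AF | ∃ (μ ν : Br.FinPath N)
      (h : μ.range = ν.range), T = matrixUnit μ ν h}).map
        (Subalgebra.toSubmodule Br.AF.toSubalgebra).subtype := by
    rw [Submodule.map_span, levelSpan]
    congr 1
    ext T
    constructor
    · rintro ⟨κ, l, h', rfl⟩
      exact ⟨matrixUnit κ l h', ⟨κ, l, h', rfl⟩, rfl⟩
    · rintro ⟨_, ⟨κ, l, h', rfl⟩, rfl⟩
      exact ⟨κ, l, h', rfl⟩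
  rw [h2] at h1
  obtain ⟨y, hy, e⟩ := h1
  have : y = matrixUnit μ ν h := Subtype.ext e
  rwa [← this]

theorem bilinear_mem_of_matrixUnit {E : Type*} [NormedAddCommGroup E] [NormedSpace ℂ E]
    (f : Br.AF →L[ℂ] Br'.AF →L[ℂ] E) {W : Submodule ℂ E} (hW : IsClosed (W : Set E))
    (h : ∀ (n : ℕ) (μ ν : Br.FinPath n) (hμ : μ.range = ν.range) (κ l : Br'.FinPath n)
      (hκ : κ.range = l.range), f (matrixUnit μ ν hμ) (matrixUnit κ l hκ) ∈ W)
    (a : Br.AF) (b : Br'.AF) : f a b ∈ W := by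
  refine continuousLinearMap₂_mem_of_dense_span
    (S := fun N => {T : Br.AF | ∃ (μ ν : Br.FinPath N) (h : μ.range = ν.range),
      T = matrixUnit μ ν h})
    (S' := fun N => {T : Br'.AF | ∃ (μ ν : Br'.FinPath N) (h : μ.range = ν.range),
      T = matrixUnit μ ν h}) ?_ ?_ ?_ ?_ f hW ?_ a b
  · rintro n N hN _ ⟨μ, ν, h, rfl⟩
    exact matrixUnit_mem_span_level hN μ ν h
  · rintro n N hN _ ⟨μ, ν, h, rfl⟩
    exact matrixUnit_mem_span_level hN μ ν h
  · refine dense_span_matrixUnits.mono (Submodule.span_mono ?_)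
    rintro _ ⟨n, μ, ν, h, rfl⟩
    exact Set.mem_iUnion.2 ⟨n, μ, ν, h, rfl⟩
  · refine dense_span_matrixUnits.mono (Submodule.span_mono ?_)
    rintro _ ⟨n, μ, ν, h, rfl⟩
    exact Set.mem_iUnion.2 ⟨n, μ, ν, h, rfl⟩
  · rintro n _ ⟨μ, ν, hμ, rfl⟩ _ ⟨κ, l, hκ, rfl⟩
    exact h n μ ν hμ κ l hκ

theorem bilinear_ext_of_matrixUnit {E : Type*} [NormedAddCommGroup E] [NormedSpace ℂ E]
    (f g : Br.AF →L[ℂ] Br'.AF →L[ℂ] E)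
    (h : ∀ (n : ℕ) (μ ν : Br.FinPath n) (hμ : μ.range = ν.range) (κ l : Br'.FinPath n)
      (hκ : κ.range = l.range), f (matrixUnit μ ν hμ) (matrixUnit κ l hκ)
        = g (matrixUnit μ ν hμ) (matrixUnit κ l hκ)) (a : Br.AF) (b : Br'.AF) :
    f a b = g a b := by
  have := bilinear_mem_of_matrixUnit (f - g) (W := ⊥) isClosed_singleton
    (fun n μ ν hμ κ l hκ => sub_eq_zero.2 (h n μ ν hμ κ l hκ)) a b
  exact sub_eq_zero.1 this

variable (Br Br') in
/-- The tensor products of matrix units of the same level. -/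
def tensorMatrixUnits : Set (spatialTensor Br.AF Br'.AF) :=
  {T | ∃ (n : ℕ) (μ ν : Br.FinPath n) (hμ : μ.range = ν.range) (κ l : Br'.FinPath n)
    (hκ : κ.range = l.range), T = elemTensor (matrixUnit μ ν hμ) (matrixUnit κ l hκ)}

theorem dense_span_tensorMatrixUnits :
    Dense (Submodule.span ℂ (tensorMatrixUnits Br Br') : Set (spatialTensor Br.AF Br'.AF)) := by
  refine dense_span_of_subset_closure dense_span_elemTensor ?_
  rintro _ ⟨a, b, rfl⟩
  exact bilinear_mem_of_matrixUnit (elemTensorL Br.AF Br'.AF)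
    (Submodule.isClosed_topologicalClosure (Submodule.span ℂ (tensorMatrixUnits Br Br')))
    (fun n μ ν hμ κ l hκ => subset_closure
      (Submodule.subset_span ⟨n, μ, ν, hμ, κ, l, hκ, rfl⟩)) a b

end BratteliDiagram

/-! ### The product diagram and its path space -/

namespace BratteliDiagram

variable {Br Br' : BratteliDiagram}

variable (Br Br') in
/-- The product of two Bratteli diagrams, formed level by level. -/
def prod : BratteliDiagram where
  Vertex n := Br.Vertex n × Br'.Vertex n
  Arrow n := Br.Arrow n × Br'.Arrow n
  src a := (Br.src a.1, Br'.src a.2)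
  rng a := (Br.rng a.1, Br'.rng a.2)
  finite_vertex n := by
    have := Br.finite_vertex n
    have := Br'.finite_vertex n
    infer_instance
  finite_emitted v := Set.toFinite _
  top := (Br.top, Br'.top)
  eq_top v := Prod.ext (Br.eq_top v.1) (Br'.eq_top v.2)
  no_sinks v := by
    obtain ⟨a, ha⟩ := Br.no_sinks v.1
    obtain ⟨b, hb⟩ := Br'.no_sinks v.2
    exact ⟨(a, b), Prod.ext ha hb⟩
  no_other_sources v := by
    obtain ⟨a, ha⟩ := Br.no_other_sources v.1
    obtain ⟨b, hb⟩ := Br'.no_other_sources v.2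
    exact ⟨(a, b), Prod.ext ha hb⟩

/-- The first component of an infinite path in a product. -/
def InfPath.fst (z : (prod Br Br').InfPath) : Br.InfPath where
  arrow i := (z.arrow i).1
  comp i := congrArg Prod.fst (z.comp i)

/-- The second component of an infinite path in a product. -/
def InfPath.snd (z : (prod Br Br').InfPath) : Br'.InfPath where
  arrow i := (z.arrow i).2
  comp i := congrArg Prod.snd (z.comp i)

/-- The infinite path in a product with given components. -/
def InfPath.pair (x : Br.InfPath) (y : Br'.InfPath) : (prod Br Br').InfPath where
  arrow i := (x.arrow i, y.arrow i)
  comp i := Prod.ext (x.comp i) (y.comp i)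

theorem InfPath.prod_ext {z w : (prod Br Br').InfPath} (h₁ : z.fst = w.fst) (h₂ : z.snd = w.snd) :
    z = w :=
  InfPath.ext (funext fun i => Prod.ext (congrFun (congrArg InfPath.arrow h₁) i)
    (congrFun (congrArg InfPath.arrow h₂) i))

/-- The first component of a finite path in a product. -/
def FinPath.fst {n : ℕ} (ρ : (prod Br Br').FinPath n) : Br.FinPath n where
  arrow i hi := (ρ.arrow i hi).1
  comp i hi := congrArg Prod.fst (ρ.comp i hi)

/-- The second component of a finite path in a product. -/
def FinPath.snd {n : ℕ} (ρ : (prod Br Br').FinPath n) : Br'.FinPath n where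
  arrow i hi := (ρ.arrow i hi).2
  comp i hi := congrArg Prod.snd (ρ.comp i hi)

/-- The finite path in a product with given components. -/
def FinPath.pair {n : ℕ} (μ : Br.FinPath n) (κ : Br'.FinPath n) : (prod Br Br').FinPath n where
  arrow i hi := (μ.arrow i hi, κ.arrow i hi)
  comp i hi := Prod.ext (μ.comp i hi) (κ.comp i hi)

theorem FinPath.range_pair {n : ℕ} (μ : Br.FinPath n) (κ : Br'.FinPath n) :
    (μ.pair κ).range = (μ.range, κ.range) := by
  cases n <;> rfl

theorem FinPath.range_pair_eq {n : ℕ} {μ ν : Br.FinPath n} (hμ : μ.range = ν.range)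
    {κ l : Br'.FinPath n} (hκ : κ.range = l.range) : (μ.pair κ).range = (ν.pair l).range := by
  rw [range_pair, range_pair, hμ, hκ]

theorem FinPath.range_fst {n : ℕ} (ρ : (prod Br Br').FinPath n) : ρ.fst.range = ρ.range.1 := by
  cases n <;> rfl

theorem FinPath.range_snd {n : ℕ} (ρ : (prod Br Br').FinPath n) : ρ.snd.range = ρ.range.2 := by
  cases n <;> rfl

theorem InfPath.startsWith_pair {n : ℕ} {z : (prod Br Br').InfPath} {μ : Br.FinPath n}
    {κ : Br'.FinPath n} :
    z.StartsWith (μ.pair κ) ↔ z.fst.StartsWith μ ∧ z.snd.StartsWith κ :=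
  ⟨fun h => ⟨fun i hi => congrArg Prod.fst (h i hi), fun i hi => congrArg Prod.snd (h i hi)⟩,
    fun h i hi => Prod.ext (h.1 i hi) (h.2 i hi)⟩

theorem InfPath.fst_replace_pair {n : ℕ} (z : (prod Br Br').InfPath) (ν : Br.FinPath n)
    (l : Br'.FinPath n) (h : (ν.pair l).range = (prod Br Br').src (z.arrow n))
    (h' : ν.range = Br.src (z.fst.arrow n)) :
    (z.replace (ν.pair l) h).fst = z.fst.replace ν h' := by
  ext i
  change ((z.replace (ν.pair l) h).arrow i).1 = _
  rw [InfPath.replace_arrow, InfPath.replace_arrow]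
  split_ifs <;> rfl

theorem InfPath.snd_replace_pair {n : ℕ} (z : (prod Br Br').InfPath) (ν : Br.FinPath n)
    (l : Br'.FinPath n) (h : (ν.pair l).range = (prod Br Br').src (z.arrow n))
    (h' : l.range = Br'.src (z.snd.arrow n)) :
    (z.replace (ν.pair l) h).snd = z.snd.replace l h' := by
  ext i
  change ((z.replace (ν.pair l) h).arrow i).2 = _
  rw [InfPath.replace_arrow, InfPath.replace_arrow]
  split_ifs <;> rfl

/-- The potential `F(a) - F'(b)` on a product of Bratteli diagrams. -/
def diffPotential (F : Br.Potential) (F' : Br'.Potential) : (prod Br Br').Potential :=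
  fun n a => F n a.1 - F' n a.2

theorem energy_pair (F : Br.Potential) (F' : Br'.Potential) {n : ℕ} (μ : Br.FinPath n)
    (κ : Br'.FinPath n) :
    (μ.pair κ).energy (diffPotential F F') = μ.energy F - κ.energy F' :=
  Finset.sum_sub_distrib _ _

/-- The standard basis vector of `ℓ²` at an infinite path. -/
noncomputable def pathVector (x : Br.InfPath) : ℓ²(Br.InfPath, ℂ) := by
  classical exact lp.single 2 x 1

theorem inner_pathVector (x : Br.InfPath) (ξ : ℓ²(Br.InfPath, ℂ)) :
    inner ℂ (pathVector x) ξ = ξ x := by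
  classical
  exact inner_single_one x ξ

open Classical in
theorem pathVector_apply (x y : Br.InfPath) : pathVector x y = if y = x then 1 else 0 := by
  rw [pathVector, lp.single_apply, Pi.single_apply]

theorem dense_span_pathVector :
    Dense (Submodule.span ℂ (Set.range (pathVector (Br := Br))) : Set ℓ²(Br.InfPath, ℂ)) := by
  classical
  let b : HilbertBasis Br.InfPath ℂ ℓ²(Br.InfPath, ℂ) := .ofRepr (.refl ℂ _)
  have hb : ∀ x, b x = pathVector x := fun x => (b.repr_symm_single x).symm
  have h := b.dense_span
  rw [show (b : Br.InfPath → ℓ²(Br.InfPath, ℂ)) = pathVector from funext hb] at h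
  exact Submodule.dense_iff_topologicalClosure_eq_top.2 h

theorem orthonormal_tmul_pathVector : Orthonormal ℂ fun z : (prod Br Br').InfPath =>
    hilbertTmul (pathVector z.fst) (pathVector z.snd) := by
  classical
  rw [orthonormal_iff_ite]
  intro z w
  rw [inner_hilbertTmul, inner_pathVector, inner_pathVector, pathVector_apply, pathVector_apply]
  by_cases h₁ : z.fst = w.fst
  · by_cases h₂ : z.snd = w.snd
    · simp [InfPath.prod_ext h₁ h₂]
    · have : z ≠ w := fun h => h₂ (h ▸ rfl)
      simp [h₂, this]
  · have : z ≠ w := fun h => h₁ (h ▸ rfl)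
    simp [h₁, this]

/-- Approximate `η`, then `ξ`, by combinations of basis vectors; any two infinite paths pair to a
path of the product. -/
theorem dense_span_tmul_pathVector : ⊤ ≤ (Submodule.span ℂ (Set.range
    fun z : (prod Br Br').InfPath =>
      hilbertTmul (pathVector z.fst) (pathVector z.snd))).topologicalClosure := by
  refine fun v _ => dense_span_of_subset_closure dense_span_hilbertTmul ?_ v
  rintro _ ⟨ξ, η, rfl⟩
  refine continuousLinearMap_mem_of_dense_span dense_span_pathVector (hilbertTmulL ξ)
    (Submodule.isClosed_topologicalClosure _) ?_ η
  rintro _ ⟨y, rfl⟩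
  refine continuousLinearMap_mem_of_dense_span dense_span_pathVector
    (hilbertTmulL.flip (pathVector y)) (Submodule.isClosed_topologicalClosure _) ?_ ξ
  rintro _ ⟨x, rfl⟩
  exact subset_closure (Submodule.subset_span ⟨x.pair y, rfl⟩)

variable (Br Br') in
/-- The unitary identification of `ℓ²(X) ⊗ ℓ²(Y)` with `ℓ²(X × Y)`, for path spaces `X`, `Y`. -/
noncomputable def pathTensorEquiv :
    HilbertTensor ℓ²(Br.InfPath, ℂ) ℓ²(Br'.InfPath, ℂ) ≃ₗᵢ[ℂ] ℓ²((prod Br Br').InfPath, ℂ) :=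
  (HilbertBasis.mk orthonormal_tmul_pathVector dense_span_tmul_pathVector).repr

theorem pathTensorEquiv_hilbertTmul (ξ : ℓ²(Br.InfPath, ℂ)) (η : ℓ²(Br'.InfPath, ℂ))
    (z : (prod Br Br').InfPath) :
    pathTensorEquiv Br Br' (hilbertTmul ξ η) z = ξ z.fst * η z.snd := by
  rw [pathTensorEquiv, HilbertBasis.repr_apply_apply, HilbertBasis.coe_mk, inner_hilbertTmul,
    inner_pathVector, inner_pathVector]

/-- The unitary `U` turns `ξ ⊗ η` into the function `ξ(x) η(y)`, and replacing a prefix of a paired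
path is done in each component. So `U (E ⊗ E') = E'' U` holds on elementary tensors, hence
everywhere. -/
theorem conj_opTensor_matrixUnitOp {n : ℕ} (μ ν : Br.FinPath n) (hμ : μ.range = ν.range)
    (κ l : Br'.FinPath n) (hκ : κ.range = l.range) :
    (pathTensorEquiv Br Br').conjStarAlgEquiv
        (opTensor (matrixUnitOp μ ν hμ) (matrixUnitOp κ l hκ))
      = matrixUnitOp (μ.pair κ) (ν.pair l) (FinPath.range_pair_eq hμ hκ) := by
  have key : (pathTensorEquiv Br Br' : _ →L[ℂ] _).comp
      (opTensor (matrixUnitOp μ ν hμ) (matrixUnitOp κ l hκ))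
      = (matrixUnitOp (μ.pair κ) (ν.pair l) (FinPath.range_pair_eq hμ hκ)).comp
        (pathTensorEquiv Br Br' : _ →L[ℂ] _) := by
    refine hilbertTensor_ext fun ξ η => ?_
    ext z
    change pathTensorEquiv Br Br' (opTensor _ _ (hilbertTmul ξ η)) z
      = matrixUnitOp _ _ _ (pathTensorEquiv Br Br' (hilbertTmul ξ η)) z
    rw [opTensor_hilbertTmul, pathTensorEquiv_hilbertTmul, matrixUnitOp_apply, matrixUnitOp_apply,
      matrixUnitOp_apply]
    by_cases h₁ : z.fst.StartsWith μ
    · by_cases h₂ : z.snd.StartsWith κ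
      · rw [dif_pos h₁, dif_pos h₂, dif_pos (InfPath.startsWith_pair.2 ⟨h₁, h₂⟩),
          pathTensorEquiv_hilbertTmul, InfPath.fst_replace_pair, InfPath.snd_replace_pair]
      · rw [dif_neg h₂, dif_neg fun h => h₂ (InfPath.startsWith_pair.1 h).2, mul_zero]
    · rw [dif_neg h₁, dif_neg fun h => h₁ (InfPath.startsWith_pair.1 h).1, zero_mul]
  ext1 ζ
  have := DFunLike.congr_fun key ((pathTensorEquiv Br Br').symm ζ)
  change pathTensorEquiv Br Br' (opTensor _ _ ((pathTensorEquiv Br Br').symm ζ))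
    = matrixUnitOp _ _ _ (pathTensorEquiv Br Br' ((pathTensorEquiv Br Br').symm ζ)) at this
  rw [LinearIsometryEquiv.apply_symm_apply] at this
  exact this

end BratteliDiagram

/-! ### The tensor product as the AF-algebra of the product diagram -/

/-- A `*`-isomorphism restricts to an isomorphism between corresponding `*`-subalgebras. -/
def StarAlgEquiv.restrictSubalgebras {B C : Type*} [CStarAlgebra B] [CStarAlgebra C]
    (φ : B ≃⋆ₐ[ℂ] C) (S : StarSubalgebra ℂ B) (T : StarSubalgebra ℂ C)
    (h : ∀ x ∈ S, φ x ∈ T) (h' : ∀ y ∈ T, φ.symm y ∈ S) : S ≃⋆ₐ[ℂ] T where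
  toFun b := ⟨φ b, h b b.2⟩
  invFun c := ⟨φ.symm c, h' c c.2⟩
  left_inv _ := Subtype.ext (φ.symm_apply_apply _)
  right_inv _ := Subtype.ext (φ.apply_symm_apply _)
  map_mul' a b := Subtype.ext (map_mul φ (a : B) b)
  map_add' a b := Subtype.ext (map_add φ (a : B) b)
  map_star' a := Subtype.ext (map_star φ (a : B))
  map_smul' c a := Subtype.ext (map_smul φ c (a : B))

theorem StarAlgEquiv.mem_of_closure_span {B C : Type*} [CStarAlgebra B] [CStarAlgebra C]
    (φ : B ≃⋆ₐ[ℂ] C) {S : StarSubalgebra ℂ B} {M : Set B}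
    (hS : (S : Set B) = closure (Submodule.span ℂ M : Set B)) {T : StarSubalgebra ℂ C}
    (hT : IsClosed (T : Set C)) (h : ∀ m ∈ M, φ m ∈ T) : ∀ b ∈ S, φ b ∈ T := by
  intro b hb
  have hb' : b ∈ closure (Submodule.span ℂ M : Set B) := by rw [← hS]; exact hb
  refine closure_minimal (t := φ ⁻¹' (T : Set C)) ?_
    (hT.preimage (StarAlgEquiv.isometry φ).continuous) hb'
  exact Submodule.span_le (p := (Subalgebra.toSubmodule T.toSubalgebra).comap
    (φ : B →ₐ[ℂ] C).toLinearMap).2 h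

theorem coe_eq_closure_of_dense_span {B : Type*} [CStarAlgebra B] {A : StarSubalgebra ℂ B}
    (hA : IsClosed (A : Set B)) {S : Set A} (hS : Dense (Submodule.span ℂ S : Set A)) :
    (A : Set B) = closure (Submodule.span ℂ (Subtype.val '' S) : Set B) := by
  refine Set.Subset.antisymm (fun x hx => ?_) ?_
  · have h := hS ⟨x, hx⟩
    rw [Topology.IsInducing.subtypeVal.closure_eq_preimage_closure_image] at h
    change x ∈ closure ((Subalgebra.toSubmodule A.toSubalgebra).subtype '' Submodule.span ℂ S) at h
    rw [← Submodule.map_coe, Submodule.map_span] at h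
    exact h
  · refine closure_minimal (fun x hx => ?_) hA
    refine Submodule.span_le (p := Subalgebra.toSubmodule A.toSubalgebra).2 ?_ hx
    rintro _ ⟨y, _, rfl⟩
    exact y.2

namespace BratteliDiagram

variable {Br Br' : BratteliDiagram}

attribute [local instance] spatialTensorCStarAlgebra spatialTensorNormedAddCommGroup
  spatialTensorNormedSpace spatialTensorModule spatialTensorTopologicalSpace
  spatialTensor_continuousAdd

theorem coe_spatialTensor_AF_eq_closure :
    SetLike.coe (spatialTensor Br.AF Br'.AF)
      = closure (SetLike.coe (Submodule.span ℂ (Subtype.val '' tensorMatrixUnits Br Br'))) :=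
  coe_eq_closure_of_dense_span (cstarGenerated_isClosed _) dense_span_tensorMatrixUnits

theorem conj_mem_AF : ∀ T ∈ spatialTensor Br.AF Br'.AF,
    (pathTensorEquiv Br Br').conjStarAlgEquiv T ∈ (prod Br Br').AF := by
  have hS := coe_spatialTensor_AF_eq_closure (Br := Br) (Br' := Br')
  refine StarAlgEquiv.mem_of_closure_span (pathTensorEquiv Br Br').conjStarAlgEquiv
    (S := spatialTensor Br.AF Br'.AF) (T := (prod Br Br').AF) hS (cstarGenerated_isClosed _) ?_
  rintro _ ⟨_, ⟨n, μ, ν, hμ, κ, l, hκ, rfl⟩, rfl⟩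
  have e := conj_opTensor_matrixUnitOp μ ν hμ κ l hκ
  change (pathTensorEquiv Br Br').conjStarAlgEquiv
    (opTensor (matrixUnitOp μ ν hμ) (matrixUnitOp κ l hκ)) ∈ _
  rw [e]
  exact mem_cstarGenerated ⟨n, _, _, _, rfl⟩

theorem conj_symm_mem_spatialTensor : ∀ T ∈ (prod Br Br').AF,
    (pathTensorEquiv Br Br').conjStarAlgEquiv.symm T ∈ spatialTensor Br.AF Br'.AF := by
  refine StarAlgEquiv.mem_of_closure_span _ coe_AF_eq_closure (cstarGenerated_isClosed _) ?_
  rintro _ ⟨n, ρ, σ, h, rfl⟩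
  have hμ : ρ.fst.range = σ.fst.range := by rw [FinPath.range_fst, FinPath.range_fst, h]
  have hκ : ρ.snd.range = σ.snd.range := by rw [FinPath.range_snd, FinPath.range_snd, h]
  have e := conj_opTensor_matrixUnitOp ρ.fst σ.fst hμ ρ.snd σ.snd hκ
  have e' := (StarAlgEquiv.symm_apply_eq _).2 e.symm
  -- A path of the product is definitionally the pair of its two components.
  change (pathTensorEquiv Br Br').conjStarAlgEquiv.symm
    (matrixUnitOp (ρ.fst.pair ρ.snd) (σ.fst.pair σ.snd) (FinPath.range_pair_eq hμ hκ)) ∈ _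
  rw [e']
  exact (elemTensor (matrixUnit ρ.fst σ.fst hμ) (matrixUnit ρ.snd σ.snd hκ)).2

variable (Br Br') in
/-- The tensor product of two AF-algebras is the AF-algebra of the product diagram. -/
noncomputable def tensorEquivAF : spatialTensor Br.AF Br'.AF ≃⋆ₐ[ℂ] (prod Br Br').AF :=
  (pathTensorEquiv Br Br').conjStarAlgEquiv.restrictSubalgebras (spatialTensor Br.AF Br'.AF)
    (prod Br Br').AF conj_mem_AF conj_symm_mem_spatialTensor

theorem tensorEquivAF_elemTensor_matrixUnit {n : ℕ} (μ ν : Br.FinPath n) (hμ : μ.range = ν.range)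
    (κ l : Br'.FinPath n) (hκ : κ.range = l.range) :
    tensorEquivAF Br Br' (elemTensor (matrixUnit μ ν hμ) (matrixUnit κ l hκ))
      = matrixUnit (μ.pair κ) (ν.pair l) (FinPath.range_pair_eq hμ hκ) :=
  Subtype.ext (conj_opTensor_matrixUnitOp μ ν hμ κ l hκ)

end BratteliDiagram

/-! ### Product states as limits of convex combinations of vector states -/

section ProductFunctionals

variable {A B C : Type*} [CStarAlgebra A] [CStarAlgebra B] [CStarAlgebra C]

theorem weakDual_sum_prod_apply {ι κ : Type*} [Fintype ι] [Fintype κ] {u : ι → ℂ} {v : κ → ℂ}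
    {ρ : ι → WeakDual ℂ A} {ρ' : κ → WeakDual ℂ B} {R : ι × κ → WeakDual ℂ C} {a : A} {b : B}
    {c : C} (h : ∀ i j, R (i, j) c = ρ i a * ρ' j b) :
    (∑ p, (u p.1 * v p.2) • R p) c = (∑ i, u i • ρ i) a * (∑ j, v j • ρ' j) b := by
  rw [weakDual_sum_smul_apply, weakDual_sum_smul_apply, weakDual_sum_smul_apply, Finset.sum_mul_sum,
    ← Finset.univ_product_univ, Finset.sum_product]
  refine Finset.sum_congr rfl fun i _ => Finset.sum_congr rfl fun j _ => ?_
  rw [h]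
  ring

open scoped ComplexOrder in
theorem IsState.sum_prod {ι κ : Type*} [Fintype ι] [Fintype κ] {u : ι → ℂ} {v : κ → ℂ}
    {R : ι × κ → WeakDual ℂ C} (hu : ∀ i, 0 ≤ u i) (hu1 : ∑ i, u i = 1) (hv : ∀ j, 0 ≤ v j)
    (hv1 : ∑ j, v j = 1) (hR : ∀ p, IsState (R p)) :
    IsState (∑ p, (u p.1 * v p.2) • R p) := by
  refine IsState.sum (fun p _ => mul_nonneg (hu _) (hv _)) ?_ fun p _ => hR p
  rw [← Finset.univ_product_univ, Finset.sum_product, ← one_mul (1 : ℂ)]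
  nth_rewrite 1 [← hu1]
  rw [← hv1, Finset.sum_mul_sum]

/-- Taking all limits along one fixed ultrafilter lets the product formula pass to the limit without
extracting subsequences. -/
theorem exists_isState_of_tendsto_mul {τ : A → B → C} {ω : WeakDual ℂ A} {ω' : WeakDual ℂ B}
    {ρ : ℕ → WeakDual ℂ A} {ρ' : ℕ → WeakDual ℂ B} {R : ℕ → WeakDual ℂ C}
    (hR : ∀ n, IsState (R n)) (h : ∀ n a b, R n (τ a b) = ρ n a * ρ' n b)
    (hω : ∀ a, Filter.Tendsto (fun n => ρ n a) (Filter.hyperfilter ℕ) (nhds (ω a)))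
    (hω' : ∀ b, Filter.Tendsto (fun n => ρ' n b) (Filter.hyperfilter ℕ) (nhds (ω' b))) :
    ∃ Ω : WeakDual ℂ C, IsState Ω ∧ ∀ a b, Ω (τ a b) = ω a * ω' b := by
  obtain ⟨Ω, hΩ, hlim⟩ := exists_isState_tendsto_hyperfilter R hR
  refine ⟨Ω, hΩ, fun a b => tendsto_nhds_unique (hlim (τ a b)) ?_⟩
  simp only [h]
  exact (hω a).mul (hω' b)

end ProductFunctionals

/-- The bounded functionals on a `C*`-algebra, with the weak* topology. -/
abbrev CStarDual (A : Type*) [CStarAlgebra A] : Type _ := WeakDual ℂ A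

section VectorStates

variable {H : Type*} [NormedAddCommGroup H] [InnerProductSpace ℂ H] [CompleteSpace H]

variable (H) in
/-- The functional `T ↦ ⟪v, T v⟫` on the bounded operators. -/
noncomputable def vectorFunctional (v : H) : WeakDual ℂ (H →L[ℂ] H) :=
  StrongDual.toWeakDual ((innerSL ℂ v).comp (ContinuousLinearMap.apply ℂ H v))

open scoped ComplexOrder in
theorem isState_vectorFunctional {v : H} (hv : ‖v‖ = 1) : IsState (vectorFunctional H v) := by
  refine ⟨fun T => ?_, ?_⟩
  · change 0 ≤ inner ℂ v (star T (T v))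
    rw [ContinuousLinearMap.star_eq_adjoint, ContinuousLinearMap.adjoint_inner_right,
      inner_self_eq_norm_sq_to_K]
    change (0 : ℂ) ≤ ((‖T v‖ : ℝ) : ℂ) ^ 2
    rw [← Complex.ofReal_pow]
    exact Complex.zero_le_real.2 (sq_nonneg _)
  · change inner ℂ v v = (1 : ℂ)
    rw [inner_self_eq_norm_sq_to_K, hv]
    simp

theorem vectorFunctional_hilbertTmul_opTensor {K : Type*} [NormedAddCommGroup K]
    [InnerProductSpace ℂ K] [CompleteSpace K] (x : H) (y : K) (a : H →L[ℂ] H) (b : K →L[ℂ] K) :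
    vectorFunctional _ (hilbertTmul x y) (opTensor a b)
      = vectorFunctional H x a * vectorFunctional K y b := by
  change inner ℂ (hilbertTmul x y) (opTensor a b (hilbertTmul x y)) = _
  rw [opTensor_hilbertTmul, inner_hilbertTmul]
  rfl

/-- The restriction of a functional to a `*`-subalgebra. -/
noncomputable def WeakDual.restrict {B : Type*} [CStarAlgebra B] (S : StarSubalgebra ℂ B)
    [IsClosed (S : Set B)] (ρ : WeakDual ℂ B) : WeakDual ℂ S :=
  StrongDual.toWeakDual ⟨(WeakDual.toStrongDual ρ).toLinearMap.comp
    (Subalgebra.toSubmodule S.toSubalgebra).subtype,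
    (WeakDual.toStrongDual ρ).continuous.comp continuous_subtype_val⟩

theorem IsState.restrict {B : Type*} [CStarAlgebra B] (S : StarSubalgebra ℂ B)
    [IsClosed (S : Set B)] {ρ : WeakDual ℂ B} (hρ : IsState ρ) : IsState (ρ.restrict S) :=
  ⟨fun a => hρ.1 a, hρ.2⟩

end VectorStates

namespace BratteliDiagram

variable {Br Br' : BratteliDiagram}

attribute [local instance] spatialTensorCStarAlgebra spatialTensorNormedAddCommGroup
  spatialTensorNormedSpace spatialTensorModule spatialTensorTopologicalSpace
  spatialTensor_continuousAdd

theorem norm_pathVector (x : Br.InfPath) : ‖pathVector x‖ = 1 := by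
  classical
  have h : ‖pathVector x‖ ^ 2 = 1 := by
    have e := inner_self_eq_norm_sq_to_K (𝕜 := ℂ) (pathVector x)
    rw [inner_pathVector, pathVector_apply, if_pos rfl] at e
    have : (1 : ℂ) = ((‖pathVector x‖ : ℝ) : ℂ) ^ 2 := e
    exact_mod_cast this.symm
  exact (pow_eq_one_iff_of_nonneg (norm_nonneg _) two_ne_zero).1 h

open Classical in
theorem vectorFunctional_pathVector_matrixUnitOp (x : Br.InfPath) {n : ℕ} (μ ν : Br.FinPath n)
    (h : μ.range = ν.range) : vectorFunctional _ (pathVector x) (matrixUnitOp μ ν h)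
      = if x.StartsWith μ ∧ μ = ν then 1 else 0 := by
  change inner ℂ (pathVector x) (matrixUnitOp μ ν h (pathVector x)) = _
  rw [inner_pathVector, matrixUnitOp_apply]
  by_cases hx : x.StartsWith μ
  · rw [dif_pos hx, pathVector_apply]
    by_cases hμ : μ = ν
    · subst hμ
      rw [if_pos (hx.replace_eq _), if_pos ⟨hx, rfl⟩]
    · rw [if_neg, if_neg fun hc => hμ hc.2]
      intro hc
      have h1 := x.replace_startsWith ν (h ▸ hx.range_eq)
      rw [hc] at h1
      exact hμ ((InfPath.startsWith_iff.1 hx).symm.trans (InfPath.startsWith_iff.1 h1))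
  · rw [dif_neg hx, if_neg fun hc => hx hc.1]

open scoped ComplexOrder in
theorem isState_apply_matrixUnit_nonneg {ω : CStarDual Br.AF} (hω : IsState ω) {n : ℕ}
    (μ : Br.FinPath n) : 0 ≤ ω (matrixUnit μ μ rfl) := by
  have := hω.1 (matrixUnit μ μ rfl)
  rwa [star_matrixUnit, matrixUnit_mul_matrixUnit] at this

theorem isState_sum_apply_matrixUnit {ω : CStarDual Br.AF} (hω : IsState ω) (n : ℕ) :
    ∑ μ : Br.FinPath n, ω (matrixUnit μ μ rfl) = 1 := by
  classical
  let μ₀ : Br.FinPath 0 := ⟨fun _ h => absurd h (by omega), fun _ h => absurd h (by omega)⟩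
  have h := hω.2
  rw [one_eq_matrixUnit μ₀, matrixUnit_self_eq_sum n.zero_le, map_sum] at h
  rw [← h]
  refine Finset.sum_congr rfl fun κ _ => ?_
  have hκ : κ.extend.StartsWith μ₀ := fun i hi => absurd hi (by omega)
  rw [if_pos hκ]

/-- The convex combination, with the weights of `ω`, of the vector states at chosen infinite
extensions of the paths of length `n`. -/
noncomputable def pathState (ω : CStarDual Br.AF) (n : ℕ) : CStarDual Br.AF :=
  ∑ κ : Br.FinPath n, ω (matrixUnit κ κ rfl) •
    (vectorFunctional _ (pathVector κ.extend)).restrict Br.AF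

theorem isState_pathState {ω : CStarDual Br.AF} (hω : IsState ω) (n : ℕ) :
    IsState (pathState ω n) :=
  IsState.sum (fun _ _ => isState_apply_matrixUnit_nonneg hω _)
    (isState_sum_apply_matrixUnit hω n)
    fun _ _ => (isState_vectorFunctional (norm_pathVector _)).restrict _

theorem pathState_apply (ω : CStarDual Br.AF) (n : ℕ) (a : Br.AF) :
    pathState ω n a = ∑ κ : Br.FinPath n, ω (matrixUnit κ κ rfl) *
      vectorFunctional _ (pathVector κ.extend) a :=
  weakDual_sum_smul_apply _ _ _ _

/-- The functional vanishes at the off-diagonal matrix units. -/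
def IsDiagonal (ω : CStarDual Br.AF) : Prop :=
  ∀ (n : ℕ) (μ ν : Br.FinPath n) (h : μ.range = ν.range), μ ≠ ν → ω (matrixUnit μ ν h) = 0

/-- The vector state at `δ_x` gives `E_{μ,μ}` the value `1` or `0` according to whether `x` begins
with `μ`. Summing the weights `ω(E_{κ,κ})` over the `κ` that begin with `μ` returns `ω(E_{μ,μ})`.
Off the diagonal both functionals vanish. -/
theorem pathState_matrixUnit {ω : CStarDual Br.AF} (hω : IsDiagonal ω) {n N : ℕ} (hN : n ≤ N)
    (μ ν : Br.FinPath n) (h : μ.range = ν.range) :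
    pathState ω N (matrixUnit μ ν h) = ω (matrixUnit μ ν h) := by
  classical
  have e : pathState ω N (matrixUnit μ ν h) = ∑ κ : Br.FinPath N, ω (matrixUnit κ κ rfl) *
      if κ.extend.StartsWith μ ∧ μ = ν then 1 else 0 := by
    rw [pathState_apply]
    exact Finset.sum_congr rfl fun κ _ =>
      congrArg _ (vectorFunctional_pathVector_matrixUnitOp κ.extend μ ν h)
  rw [e]
  by_cases hμ : μ = ν
  · subst hμ
    rw [matrixUnit_self_eq_sum hN, map_sum]
    refine Finset.sum_congr rfl fun κ _ => ?_
    by_cases hκ : κ.extend.StartsWith μ <;> simp [hκ]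
  · rw [hω n μ ν h hμ]
    refine Finset.sum_eq_zero fun κ _ => ?_
    rw [if_neg fun hc => hμ hc.2, mul_zero]

/-- On each matrix unit the sequence is eventually constant, equal to the value of `ω`. A pointwise
limit exists by compactness, and density identifies it with `ω`. -/
theorem tendsto_pathState {ω : CStarDual Br.AF} (hω : IsState ω) (hd : IsDiagonal ω) (a : Br.AF) :
    Filter.Tendsto (fun n => pathState ω n a) (Filter.hyperfilter ℕ) (nhds (ω a)) := by
  obtain ⟨σ, -, h⟩ := exists_isState_tendsto_hyperfilter _ (isState_pathState hω)
  have : σ = ω := by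
    refine weakDual_ext_of_dense_span dense_span_matrixUnits ?_
    rintro _ ⟨n, μ, ν, hμ, rfl⟩
    refine tendsto_nhds_unique (h (matrixUnit μ ν hμ)) (tendsto_const_nhds.congr' ?_)
    refine Filter.Eventually.filter_mono Nat.hyperfilter_le_atTop ?_
    filter_upwards [Filter.eventually_ge_atTop n] with N hN
    exact (pathState_matrixUnit hd hN μ ν hμ).symm
  rw [this] at h
  exact h a

theorem norm_hilbertTmul_pathVector (x : Br.InfPath) (y : Br'.InfPath) :
    ‖hilbertTmul (pathVector x) (pathVector y)‖ = 1 := by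
  rw [hilbertTmul, UniformSpace.Completion.norm_coe, TensorProduct.norm_tmul, norm_pathVector,
    norm_pathVector, one_mul]

/-- The vector state at an elementary tensor of standard basis vectors. -/
noncomputable def tensorVectorState (x : Br.InfPath) (y : Br'.InfPath) :
    CStarDual (spatialTensor Br.AF Br'.AF) :=
  WeakDual.restrict (spatialTensor Br.AF Br'.AF)
    (vectorFunctional _ (hilbertTmul (pathVector x) (pathVector y)))

theorem isState_tensorVectorState (x : Br.InfPath) (y : Br'.InfPath) :
    IsState (tensorVectorState x y) :=
  (isState_vectorFunctional (norm_hilbertTmul_pathVector x y)).restrict _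

theorem tensorVectorState_elemTensor (x : Br.InfPath) (y : Br'.InfPath) (a : Br.AF) (b : Br'.AF) :
    tensorVectorState x y (elemTensor a b)
      = (vectorFunctional _ (pathVector x)).restrict Br.AF a *
        (vectorFunctional _ (pathVector y)).restrict Br'.AF b :=
  vectorFunctional_hilbertTmul_opTensor (pathVector x) (pathVector y) a b

/-- The convex combination of the tensor products of the vector states in `pathState`. -/
noncomputable def tensorPathState (ω : CStarDual Br.AF) (ω' : CStarDual Br'.AF) (n : ℕ) :
    CStarDual (spatialTensor Br.AF Br'.AF) :=
  ∑ p : Br.FinPath n × Br'.FinPath n,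
    (ω (matrixUnit p.1 p.1 rfl) * ω' (matrixUnit p.2 p.2 rfl)) •
      tensorVectorState p.1.extend p.2.extend

theorem isState_tensorPathState {ω : CStarDual Br.AF} {ω' : CStarDual Br'.AF} (hω : IsState ω)
    (hω' : IsState ω') (n : ℕ) : IsState (tensorPathState ω ω' n) :=
  IsState.sum_prod (C := spatialTensor Br.AF Br'.AF)
    (u := fun κ : Br.FinPath n => ω (matrixUnit κ κ rfl))
    (v := fun l : Br'.FinPath n => ω' (matrixUnit l l rfl))
    (R := fun p : Br.FinPath n × Br'.FinPath n => tensorVectorState p.1.extend p.2.extend)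
    (fun _ => isState_apply_matrixUnit_nonneg hω _)
    (isState_sum_apply_matrixUnit hω n) (fun _ => isState_apply_matrixUnit_nonneg hω' _)
    (isState_sum_apply_matrixUnit hω' n) fun _ => isState_tensorVectorState _ _

theorem tensorPathState_elemTensor (ω : CStarDual Br.AF) (ω' : CStarDual Br'.AF) (n : ℕ)
    (a : Br.AF) (b : Br'.AF) :
    tensorPathState ω ω' n (elemTensor a b) = pathState ω n a * pathState ω' n b :=
  weakDual_sum_prod_apply (A := Br.AF) (B := Br'.AF) (C := spatialTensor Br.AF Br'.AF)
    (u := fun κ : Br.FinPath n => ω (matrixUnit κ κ rfl))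
    (v := fun l : Br'.FinPath n => ω' (matrixUnit l l rfl))
    (R := fun p : Br.FinPath n × Br'.FinPath n => tensorVectorState p.1.extend p.2.extend)
    (ρ := fun κ => (vectorFunctional _ (pathVector κ.extend)).restrict Br.AF)
    (ρ' := fun l => (vectorFunctional _ (pathVector l.extend)).restrict Br'.AF)
    fun κ l => tensorVectorState_elemTensor κ.extend l.extend a b

/-- The product of two states that vanish at the off-diagonal matrix units. -/
theorem exists_isState_elemTensor {ω : CStarDual Br.AF} {ω' : CStarDual Br'.AF}
    (hω : IsState ω) (hω' : IsState ω') (hd : IsDiagonal ω) (hd' : IsDiagonal ω') :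
    ∃ Ω : CStarDual (spatialTensor Br.AF Br'.AF), IsState Ω ∧
      ∀ a b, Ω (elemTensor a b) = ω a * ω' b :=
  exists_isState_of_tendsto_mul (τ := fun (a : Br.AF) (b : Br'.AF) => elemTensor a b)
    (ρ := pathState ω) (ρ' := pathState ω') (R := tensorPathState ω ω')
    (isState_tensorPathState hω hω') (tensorPathState_elemTensor ω ω') (tendsto_pathState hω hd)
    (tendsto_pathState hω' hd')

end BratteliDiagram

/-! ### KMS states of a tensor product flow, abstractly -/

section TensorKMS

variable {A B C : Type*} [CStarAlgebra A] [CStarAlgebra B] [CStarAlgebra C]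

/-- The algebraic properties of the map `(a, b) ↦ a ⊗ b` into a `C*`-tensor product. -/
structure IsTensorMap (τ : A → B → C) : Prop where
  add_left : ∀ a a' b, τ (a + a') b = τ a b + τ a' b
  add_right : ∀ a b b', τ a (b + b') = τ a b + τ a b'
  smul_left : ∀ (c : ℂ) a b, τ (c • a) b = c • τ a b
  smul_right : ∀ (c : ℂ) a b, τ a (c • b) = c • τ a b
  mul_eq : ∀ a a' b b', τ a b * τ a' b' = τ (a * a') (b * b')
  star_eq : ∀ a b, star (τ a b) = τ (star a) (star b)
  one_eq : τ 1 1 = 1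
  norm_le : ∀ a b, ‖τ a b‖ ≤ ‖a‖ * ‖b‖

namespace IsTensorMap

variable {τ : A → B → C} (hτ : IsTensorMap τ)

/-- The functional `a ↦ Ω(a ⊗ b)`. -/
noncomputable def sliceLeft (Ω : WeakDual ℂ C) (b : B) : WeakDual ℂ A :=
  StrongDual.toWeakDual ((WeakDual.toStrongDual Ω).comp (LinearMap.mkContinuous
    (IsLinearMap.mk' (fun a => τ a b) ⟨fun a a' => hτ.add_left a a' b,
      fun c a => hτ.smul_left c a b⟩) ‖b‖
    fun a => (hτ.norm_le a b).trans_eq (mul_comm _ _)))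

/-- The functional `b ↦ Ω(a ⊗ b)`. -/
noncomputable def sliceRight (Ω : WeakDual ℂ C) (a : A) : WeakDual ℂ B :=
  StrongDual.toWeakDual ((WeakDual.toStrongDual Ω).comp (LinearMap.mkContinuous
    (IsLinearMap.mk' (fun b => τ a b) ⟨fun b b' => hτ.add_right a b b',
      fun c b => hτ.smul_right c a b⟩) ‖a‖ fun b => hτ.norm_le a b))

theorem sliceLeft_apply (Ω : WeakDual ℂ C) (a : A) (b : B) : hτ.sliceLeft Ω b a = Ω (τ a b) := rfl

theorem isState_sliceLeft_one {Ω : WeakDual ℂ C} (hΩ : IsState Ω) :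
    IsState (hτ.sliceLeft Ω 1) := by
  refine ⟨fun a => ?_, ?_⟩
  · have := hΩ.1 (τ a 1)
    rwa [hτ.star_eq, hτ.mul_eq, star_one, mul_one] at this
  · rw [sliceLeft_apply, hτ.one_eq, hΩ.2]

end IsTensorMap

theorem CStarFlow.isEigenvector_one (γ : CStarFlow A) : γ.IsEigenvector 0 1 := by
  intro t
  rw [map_one]
  simp

theorem IsTensorMap.apply_eigenvectors {τ : A → B → C} (hτ : IsTensorMap τ) {γ : CStarFlow A}
    {γ' : CStarFlow B} {c c' : ℝ} {a : A} {b : B} (ha : γ.IsEigenvector c a)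
    (hb : γ'.IsEigenvector c' b) (t : ℝ) : τ (γ t a) (γ' (-t) b)
      = Complex.exp (Complex.I * t * ((c - c' : ℝ) : ℂ)) • τ a b := by
  rw [ha t, hb (-t), hτ.smul_left, hτ.smul_right, smul_smul, ← Complex.exp_add]
  congr 2
  push_cast
  ring

/-- `α` is the flow `γ_t ⊗ γ'_{-t}` on a tensor product, and the algebras are generated by sets
`S`, `S'` of eigenvectors, the elements of `S` being invariant projections or off-diagonal. -/
structure IsTensorFlow (τ : A → B → C) (γ : CStarFlow A) (γ' : CStarFlow B) (α : CStarFlow C)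
    (S : Set A) (S' : Set B) : Prop where
  isTensorMap : IsTensorMap τ
  apply_tensor : ∀ t a b, α t (τ a b) = τ (γ t a) (γ' (-t) b)
  dense_left : Dense (Submodule.span ℂ S : Set A)
  dense_right : Dense (Submodule.span ℂ S' : Set B)
  dense_tensor : Dense (Submodule.span ℂ {x | ∃ a ∈ S, ∃ b ∈ S', x = τ a b} : Set C)
  eigen_left : ∀ a ∈ S, ∃ c, γ.IsEigenvector c a
  eigen_right : ∀ b ∈ S', ∃ c, γ'.IsEigenvector c b
  diag_or_offdiag : ∀ a ∈ S, (star a = a ∧ a * a = a) ∨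
    ∃ p, (∀ t, γ t p = p) ∧ p * a = a ∧ a * p = 0

namespace IsTensorFlow

variable {τ : A → B → C} {γ : CStarFlow A} {γ' : CStarFlow B} {α : CStarFlow C} {S : Set A}
  {S' : Set B}

theorem isEigenvector (hF : IsTensorFlow τ γ γ' α S S')
    {c c' : ℝ} {a : A} {b : B} (ha : γ.IsEigenvector c a)
    (hb : γ'.IsEigenvector c' b) : α.IsEigenvector (c - c') (τ a b) :=
  fun t => (hF.apply_tensor t a b).trans (hF.isTensorMap.apply_eigenvectors ha hb t)

theorem apply_mul (hF : IsTensorFlow τ γ γ' α S S')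
    {β : ℝ} {Ω : WeakDual ℂ C} (hΩ : Ω ∈ kmsStates α β) {c : ℝ} {x : C}
    (hx : α.IsEigenvector c x) (y : C) : Ω (x * y) = Complex.exp (-(β * c)) * Ω (y * x) := by
  refine kmsStates_apply_mul hΩ hF.dense_tensor ?_ hx y
  rintro _ ⟨a, ha, b, hb, rfl⟩
  obtain ⟨c, hc⟩ := hF.eigen_left a ha
  obtain ⟨c', hc'⟩ := hF.eigen_right b hb
  exact ⟨_, hF.isEigenvector hc hc'⟩

/-- The second factor runs backwards in time and has inverse temperature `-β`, so the two
exponentials `exp(-βc)` and `exp(βc')` combine to the one for the weight `c - c'` of the tensor. -/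
theorem mem_kmsStates (hF : IsTensorFlow τ γ γ' α S S')
    {β : ℝ} {ω : WeakDual ℂ A} {ω' : WeakDual ℂ B} {Ω : WeakDual ℂ C}
    (hω : ω ∈ kmsStates γ β) (hω' : ω' ∈ kmsStates γ' (-β)) (hΩ : IsState Ω)
    (h : ∀ a b, Ω (τ a b) = ω a * ω' b) : Ω ∈ kmsStates α β := by
  refine mem_kmsStates_of_eigenvectors hΩ hF.dense_tensor ?_
  rintro _ ⟨a, ha, b, hb, rfl⟩
  obtain ⟨c, hc⟩ := hF.eigen_left a ha
  obtain ⟨c', hc'⟩ := hF.eigen_right b hb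
  refine ⟨_, hF.isEigenvector hc hc', fun y => ?_⟩
  refine continuousLinearMap_eq_of_dense_span hF.dense_tensor
    ((WeakDual.toStrongDual Ω).comp (ContinuousLinearMap.mul ℂ C (τ a b)))
    (Complex.exp (-(β * (c - c' : ℝ))) •
      (WeakDual.toStrongDual Ω).comp ((ContinuousLinearMap.mul ℂ C).flip (τ a b)))
    (fun x hx => ?_) y
  obtain ⟨a', -, b', -, rfl⟩ := hx
  change Ω (τ a b * τ a' b') = Complex.exp (-(β * (c - c' : ℝ))) * Ω (τ a' b' * τ a b)
  rw [hF.isTensorMap.mul_eq, hF.isTensorMap.mul_eq, h, h, kmsStates_apply_mul hω hF.dense_left hF.eigen_left hc a',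
    kmsStates_apply_mul hω' hF.dense_right hF.eigen_right hc' b', mul_mul_mul_comm, ← Complex.exp_add]
  congr 2
  push_cast
  ring

theorem sliceLeft_one_mem_kmsStates (hF : IsTensorFlow τ γ γ' α S S')
    {β : ℝ} {Ω : WeakDual ℂ C} (hΩ : Ω ∈ kmsStates α β) :
    hF.isTensorMap.sliceLeft Ω 1 ∈ kmsStates γ β := by
  refine mem_kmsStates_of_eigenvectors (hF.isTensorMap.isState_sliceLeft_one hΩ.1) hF.dense_left fun a ha => ?_
  obtain ⟨c, hc⟩ := hF.eigen_left a ha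
  refine ⟨c, hc, fun a' => ?_⟩
  have e := hF.apply_mul hΩ (hF.isEigenvector hc γ'.isEigenvector_one) (τ a' 1)
  rw [hF.isTensorMap.mul_eq, hF.isTensorMap.mul_eq, mul_one, sub_zero] at e
  exact e

-- Uniqueness of `ω'` enters here. Since `p` is a projection, `b ↦ Ω(p ⊗ b)` is positive, and it
-- inherits the `(-β)`-KMS relation because multiplying by `1 ⊗ b` leaves `p` alone.
open scoped ComplexOrder in
theorem apply_of_projection (hF : IsTensorFlow τ γ γ' α S S')
    {β : ℝ} {Ω : WeakDual ℂ C} (hΩ : Ω ∈ kmsStates α β)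
    {ω' : WeakDual ℂ B} (hω' : kmsStates γ' (-β) = {ω'}) {p : A} (hp : star p = p)
    (hpp : p * p = p) (b : B) : Ω (τ p b) = Ω (τ p 1) * ω' b := by
  have hmem : ω' ∈ kmsStates γ' (-β) := hω' ▸ rfl
  have hpos : ∀ b, 0 ≤ Ω (τ p (star b * b)) := fun b => by
    have := hΩ.1.1 (τ p b)
    rwa [hF.isTensorMap.star_eq, hF.isTensorMap.mul_eq, hp, hpp] at this
  have hq : 0 ≤ 1 - Ω (τ p 1) := by
    have h1 := hΩ.1.1 (τ (1 - p) 1)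
    have h2 : star (1 - p) * (1 - p) = 1 - p := by
      rw [star_sub, star_one, hp, mul_sub, sub_mul, sub_mul, hpp]
      simp
    have h3 : τ 1 1 = τ (1 - p) 1 + τ p 1 := by rw [← hF.isTensorMap.add_left, sub_add_cancel]
    rw [hF.isTensorMap.star_eq, hF.isTensorMap.mul_eq, h2, star_one, mul_one] at h1
    have h4 : Ω (τ (1 - p) 1) = 1 - Ω (τ p 1) := by
      rw [eq_sub_iff_add_eq, ← map_add, ← h3, hF.isTensorMap.one_eq, hΩ.1.2]
    rwa [h4] at h1
  -- Filling up the mass with a multiple of `ω'` instead of normalizing avoids division by `Ω(p ⊗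
  -- 1)`, which may be zero.
  have hρ : hF.isTensorMap.sliceRight Ω p + (1 - Ω (τ p 1)) • ω' ∈ kmsStates γ' (-β) := by
    have e : ∀ b, (hF.isTensorMap.sliceRight Ω p + (1 - Ω (τ p 1)) • ω') b
        = Ω (τ p b) + (1 - Ω (τ p 1)) * ω' b := fun b => rfl
    refine mem_kmsStates_of_eigenvectors ⟨fun b => ?_, ?_⟩ hF.dense_right fun b hb => ?_
    · rw [e]
      exact add_nonneg (hpos b) (mul_nonneg hq (hmem.1.1 b))
    · rw [e, hmem.1.2]
      ring
    · obtain ⟨c, hc⟩ := hF.eigen_right b hb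
      refine ⟨c, hc, fun b' => ?_⟩
      -- The weight of `1 ⊗ b` is `0 - c`; this sign turns `β` into `-β`.
      have h1 := hF.apply_mul hΩ
        (hF.isEigenvector γ.isEigenvector_one hc) (τ p b')
      rw [hF.isTensorMap.mul_eq, hF.isTensorMap.mul_eq, one_mul, mul_one] at h1
      have h2 := kmsStates_apply_mul hmem hF.dense_right hF.eigen_right hc b'
      rw [e, e, h1, h2]
      push_cast
      ring_nf
  rw [hω', Set.mem_singleton_iff] at hρ
  have h1 : Ω (τ p b) + (1 - Ω (τ p 1)) * ω' b = ω' b := DFunLike.congr_fun hρ b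
  linear_combination h1

/-- As for off-diagonal matrix units: the invariant element `p ⊗ 1` is moved from the left of `a ⊗
b` to the right. -/
theorem apply_eq_zero (hF : IsTensorFlow τ γ γ' α S S')
    {β : ℝ} {Ω : WeakDual ℂ C} (hΩ : Ω ∈ kmsStates α β) {a p : A}
    (hpγ : ∀ t, γ t p = p) (hpa : p * a = a) (hap : a * p = 0) (b : B) : Ω (τ a b) = 0 := by
  have hpe : γ.IsEigenvector 0 p := fun t => by rw [hpγ]; simp
  have h1 := hF.apply_mul hΩ (hF.isEigenvector hpe γ'.isEigenvector_one) (τ a b)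
  have h0 : τ 0 (b * 1) = 0 := by
    have := hF.isTensorMap.smul_left 0 0 (b * 1)
    rwa [zero_smul, zero_smul] at this
  rw [hF.isTensorMap.mul_eq, hF.isTensorMap.mul_eq, hpa, hap, one_mul, h0, map_zero, mul_zero] at h1
  exact h1

/-- Both sides are continuous and linear in `a`, so elements of `S` suffice: projections are handled
by uniqueness of `ω'`, the others give zero on both sides. -/
theorem apply_eq_mul (hF : IsTensorFlow τ γ γ' α S S')
    {β : ℝ} {Ω : WeakDual ℂ C} (hΩ : Ω ∈ kmsStates α β)
    {ω' : WeakDual ℂ B} (hω' : kmsStates γ' (-β) = {ω'}) (a : A) (b : B) :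
    Ω (τ a b) = Ω (τ a 1) * ω' b := by
  refine continuousLinearMap_eq_of_dense_span hF.dense_left (WeakDual.toStrongDual (hF.isTensorMap.sliceLeft Ω b))
    (ω' b • WeakDual.toStrongDual (hF.isTensorMap.sliceLeft Ω 1)) (fun a ha => ?_) a |>.trans (mul_comm _ _)
  change Ω (τ a b) = ω' b * Ω (τ a 1)
  rw [mul_comm]
  rcases hF.diag_or_offdiag a ha with ⟨h1, h2⟩ | ⟨p, h1, h2, h3⟩
  · exact hF.apply_of_projection hΩ hω' h1 h2 b
  · rw [hF.apply_eq_zero hΩ h1 h2 h3,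
      hF.apply_eq_zero hΩ h1 h2 h3, zero_mul]

theorem exists_homeomorph_kmsStates (hF : IsTensorFlow τ γ γ' α S S')
    {β : ℝ} {ω' : WeakDual ℂ B}
    (hω' : kmsStates γ' (-β) = {ω'})
    (hprod : ∀ ω ∈ kmsStates γ β, ∃ Ω : WeakDual ℂ C, IsState Ω ∧ ∀ a b, Ω (τ a b) = ω a * ω' b) :
    ∃ Φ : kmsStates γ β ≃ₜ kmsStates α β,
      (∀ (ω : kmsStates γ β) (a : A) (b : B),
        (Φ ω : WeakDual ℂ C) (τ a b) = (ω : WeakDual ℂ A) a * ω' b) ∧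
      IsAffineMapOn (convex_kmsStates γ β) Φ := by
  have hmem : ω' ∈ kmsStates γ' (-β) := hω' ▸ rfl
  have key : ∀ Ω ∈ kmsStates α β, ∀ a b, Ω (τ a b) = Ω (τ a 1) * ω' b := fun Ω hΩ a b =>
    hF.apply_eq_mul hΩ hω' a b
  have hext : ∀ Ω₁ Ω₂ : WeakDual ℂ C, (∀ a b, Ω₁ (τ a b) = Ω₂ (τ a b)) → Ω₁ = Ω₂ := by
    intro Ω₁ Ω₂ h
    refine weakDual_ext_of_dense_span hF.dense_tensor ?_
    rintro _ ⟨a, -, b, -, rfl⟩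
    exact h a b
  -- The inverse is constructed because it is plain restriction, whose weak* continuity is
  -- immediate; continuity of the product map then comes from compactness.
  let g : kmsStates α β → kmsStates γ β := fun Ω =>
    ⟨hF.isTensorMap.sliceLeft Ω 1, hF.sliceLeft_one_mem_kmsStates Ω.2⟩
  have hg : Continuous g := by
    refine Continuous.subtype_mk (WeakDual.continuous_of_continuous_eval fun a => ?_) _
    exact (WeakDual.eval_continuous (τ a 1)).comp continuous_subtype_val
  have hbij : Function.Bijective g := by
    refine ⟨fun Ω₁ Ω₂ h => Subtype.ext (hext _ _ fun a b => ?_), fun ω => ?_⟩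
    · rw [key _ Ω₁.2, key _ Ω₂.2]
      congr 1
      exact DFunLike.congr_fun (congrArg Subtype.val h) a
    · obtain ⟨Ω, hΩ, h⟩ := hprod ω ω.2
      refine ⟨⟨Ω, hF.mem_kmsStates ω.2 hmem hΩ h⟩, Subtype.ext ?_⟩
      refine DFunLike.ext _ _ fun a => ?_
      change Ω (τ a 1) = _
      rw [h, hmem.1.2, mul_one]
  have : CompactSpace (kmsStates α β) := isCompact_iff_compactSpace.1 (isCompact_kmsStates α β)
  let e := Equiv.ofBijective g hbij
  let Φ := (Continuous.homeoOfEquivCompactToT2 (f := e) hg).symm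
  have hΦ : ∀ (ω : kmsStates γ β) (a : A) (b : B),
      (Φ ω : WeakDual ℂ C) (τ a b) = (ω : WeakDual ℂ A) a * ω' b := by
    intro ω a b
    rw [key _ (Φ ω).2]
    congr 1
    have h : g (Φ ω) = ω := e.apply_symm_apply ω
    exact DFunLike.congr_fun (congrArg Subtype.val h) a
  -- A functional is determined by its values at elementary tensors, and these depend linearly on
  -- `ω`.
  refine ⟨Φ, hΦ, fun x y s t hs ht hst => hext _ _ fun a b => ?_⟩
  rw [hΦ]
  change ((s : ℂ) * (x : WeakDual ℂ A) a + (t : ℂ) * (y : WeakDual ℂ A) a) * ω' b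
    = (s : ℂ) * (Φ x : WeakDual ℂ C) (τ a b) + (t : ℂ) * (Φ y : WeakDual ℂ C) (τ a b)
  rw [hΦ, hΦ]
  ring

end IsTensorFlow

end TensorKMS

/-! ### The flow on the tensor product as a transported gauge action -/

section Transport

variable {A B : Type*} [CStarAlgebra A] [CStarAlgebra B]

/-- The flow corresponding to a given one under a `*`-isomorphism. -/
noncomputable def CStarFlow.transport (γ : CStarFlow B) (φ : A ≃⋆ₐ[ℂ] B) : CStarFlow A where
  toFun t := (φ.trans (γ t)).trans φ.symm
  map_zero a := by
    change φ.symm (γ 0 (φ a)) = a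
    rw [γ.map_zero, φ.symm_apply_apply]
  map_add s t a := by
    change φ.symm (γ (s + t) (φ a)) = φ.symm (γ s (φ (φ.symm (γ t (φ a)))))
    rw [γ.map_add, φ.apply_symm_apply]
  continuous a := (StarAlgEquiv.isometry φ.symm).continuous.comp (γ.continuous (φ a))

theorem CStarFlow.transport_apply (γ : CStarFlow B) (φ : A ≃⋆ₐ[ℂ] B) (t : ℝ) (a : A) :
    γ.transport φ t a = φ.symm (γ t (φ a)) := rfl

theorem CStarFlow.apply_transport (γ : CStarFlow B) (φ : A ≃⋆ₐ[ℂ] B) (t : ℝ) (a : A) :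
    φ (γ.transport φ t a) = γ t (φ a) := φ.apply_symm_apply _

theorem CStarFlow.transport_apply_of_isEigenvector {γ : CStarFlow B} (φ : A ≃⋆ₐ[ℂ] B) {c : ℝ}
    {a : A} (h : γ.IsEigenvector c (φ a)) : (γ.transport φ).IsEigenvector c a := by
  intro t
  rw [transport_apply, h t, map_smul, φ.symm_apply_apply]

theorem CStarFlow.ext_of_dense_span {α α' : CStarFlow A} {S : Set A}
    (hS : Dense (Submodule.span ℂ S : Set A)) (h : ∀ t, ∀ a ∈ S, α t a = α' t a) : α = α' :=
  CStarFlow.ext fun t a => continuousLinearMap_eq_of_dense_span hS (α.toCLM t) (α'.toCLM t) (h t) a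

end Transport

namespace BratteliDiagram

variable {Br Br' : BratteliDiagram}

attribute [local instance] spatialTensorCStarAlgebra spatialTensorNormedAddCommGroup
  spatialTensorNormedSpace spatialTensorModule spatialTensorTopologicalSpace
  spatialTensor_continuousAdd

theorem intertwines_of_matrixUnit {E : Type*} [NormedAddCommGroup E] [NormedSpace ℂ E]
    (f : Br.AF →L[ℂ] Br'.AF →L[ℂ] E) (T : E →L[ℂ] E) (U : Br.AF →L[ℂ] Br.AF)
    (V : Br'.AF →L[ℂ] Br'.AF)
    (h : ∀ (n : ℕ) (μ ν : Br.FinPath n) (hμ : μ.range = ν.range) (κ l : Br'.FinPath n)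
      (hκ : κ.range = l.range), T (f (matrixUnit μ ν hμ) (matrixUnit κ l hκ))
        = f (U (matrixUnit μ ν hμ)) (V (matrixUnit κ l hκ))) (a : Br.AF) (b : Br'.AF) :
    T (f a b) = f (U a) (V b) :=
  bilinear_ext_of_matrixUnit ((ContinuousLinearMap.compL ℂ Br'.AF E E T).comp f)
    (f.bilinearComp U V) h a b

theorem isTensorMap_elemTensor : IsTensorMap (A := Br.AF) (B := Br'.AF)
    (C := spatialTensor Br.AF Br'.AF) elemTensor where
  add_left a a' b := elemTensor_add_left a a' b
  add_right a b b' := elemTensor_add_right a b b'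
  smul_left c a b := elemTensor_smul_left c a b
  smul_right c a b := elemTensor_smul_right c a b
  mul_eq a a' b b' := elemTensor_mul a a' b b'
  star_eq a b := star_elemTensor a b
  one_eq := elemTensor_one
  norm_le a b := norm_opTensor_le (a : ℓ²(Br.InfPath, ℂ) →L[ℂ] ℓ²(Br.InfPath, ℂ))
    (b : ℓ²(Br'.InfPath, ℂ) →L[ℂ] ℓ²(Br'.InfPath, ℂ))

/-- The flow `α^F_t ⊗ α^{F'}_{-t}`, as a gauge action of the product diagram. -/
noncomputable def tensorFlow (F : Br.Potential) (F' : Br'.Potential) :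
    CStarFlow (spatialTensor Br.AF Br'.AF) :=
  (gaugeAction (diffPotential F F')).transport (tensorEquivAF Br Br')

theorem tensorFlow_isEigenvector (F : Br.Potential) (F' : Br'.Potential) {n : ℕ}
    (μ ν : Br.FinPath n) (hμ : μ.range = ν.range) (κ l : Br'.FinPath n) (hκ : κ.range = l.range) :
    (tensorFlow F F').IsEigenvector ((μ.energy F - ν.energy F) - (κ.energy F' - l.energy F'))
      (elemTensor (matrixUnit μ ν hμ) (matrixUnit κ l hκ)) := by
  refine CStarFlow.transport_apply_of_isEigenvector (tensorEquivAF Br Br') ?_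
  rw [tensorEquivAF_elemTensor_matrixUnit]
  have h := gaugeAction_isEigenvector (diffPotential F F') (μ.pair κ) (ν.pair l)
    (FinPath.range_pair_eq hμ hκ)
  rw [energy_pair, energy_pair, sub_sub_sub_comm] at h
  exact h

/-- `α` is the flow `α^F_t ⊗ α^{F'}_{-t}`. -/
def IsTensorGaugeFlow (F : Br.Potential) (F' : Br'.Potential)
    (α : CStarFlow (spatialTensor Br.AF Br'.AF)) : Prop :=
  ∀ (t : ℝ) (a : Br.AF) (b : Br'.AF),
    α t (elemTensor a b) = elemTensor (gaugeAction F t a) (gaugeAction F' (-t) b)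

/-- Both sides are bounded and bilinear, and on a pair of matrix units of equal level both multiply
by the same character, because the energy of a paired path is `F(μ) - F'(κ)`. -/
theorem isTensorGaugeFlow_tensorFlow (F : Br.Potential) (F' : Br'.Potential) :
    IsTensorGaugeFlow F F' (tensorFlow F F') := by
  refine fun t => intertwines_of_matrixUnit (elemTensorL Br.AF Br'.AF)
    ((tensorFlow F F').toCLM t) ((gaugeAction F).toCLM t) ((gaugeAction F').toCLM (-t))
    fun _ μ ν hμ κ l hκ => ?_
  have h₁ := tensorFlow_isEigenvector F F' μ ν hμ κ l hκ t
  have h₂ := IsTensorMap.apply_eigenvectors (A := Br.AF) (B := Br'.AF)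
    (C := spatialTensor Br.AF Br'.AF) (τ := elemTensor) isTensorMap_elemTensor
    (γ := gaugeAction F) (γ' := gaugeAction F') (a := matrixUnit μ ν hμ) (b := matrixUnit κ l hκ)
    (gaugeAction_isEigenvector F μ ν hμ) (gaugeAction_isEigenvector F' κ l hκ) t
  exact h₁.trans h₂.symm

theorem gaugeAction_matrixUnit_self (F : Br.Potential) {n : ℕ} (μ : Br.FinPath n) (t : ℝ) :
    gaugeAction F t (matrixUnit μ μ rfl) = matrixUnit μ μ rfl := by
  rw [gaugeAction_matrixUnit, sub_self, mul_zero, Complex.exp_zero, one_smul]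

/-- For `E_{μ,ν}` with `μ ≠ ν` the invariant element is `E_{μ,μ}`. -/
theorem matrixUnits_diag_or_offdiag (F : Br.Potential) : ∀ a ∈ Br.matrixUnits,
    (star a = a ∧ a * a = a) ∨
      ∃ p, (∀ t, gaugeAction F t p = p) ∧ p * a = a ∧ a * p = 0 := by
  rintro _ ⟨n, μ, ν, h, rfl⟩
  by_cases hμ : μ = ν
  · subst hμ
    exact Or.inl ⟨star_matrixUnit μ μ rfl, matrixUnit_mul_matrixUnit μ μ μ rfl rfl⟩
  · exact Or.inr ⟨matrixUnit μ μ rfl, gaugeAction_matrixUnit_self F μ,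
      matrixUnit_mul_matrixUnit μ μ ν rfl h, matrixUnit_mul_of_ne h rfl (Ne.symm hμ)⟩

theorem dense_span_matrixUnits_tensor : Dense (Submodule.span ℂ
    {x : spatialTensor Br.AF Br'.AF | ∃ a ∈ Br.matrixUnits, ∃ b ∈ Br'.matrixUnits,
      x = elemTensor a b} : Set (spatialTensor Br.AF Br'.AF)) := by
  refine dense_span_tensorMatrixUnits.mono (Submodule.span_mono ?_)
  rintro _ ⟨n, μ, ν, hμ, κ, l, hκ, rfl⟩
  exact ⟨_, ⟨n, μ, ν, hμ, rfl⟩, _, ⟨n, κ, l, hκ, rfl⟩, rfl⟩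

theorem IsTensorGaugeFlow.isTensorFlow {F : Br.Potential} {F' : Br'.Potential}
    {α : CStarFlow (spatialTensor Br.AF Br'.AF)} (hα : IsTensorGaugeFlow F F' α) :
    IsTensorFlow (A := Br.AF) (B := Br'.AF) (C := spatialTensor Br.AF Br'.AF) elemTensor
      (gaugeAction F) (gaugeAction F') α Br.matrixUnits Br'.matrixUnits where
  isTensorMap := isTensorMap_elemTensor
  apply_tensor := hα
  dense_left := dense_span_matrixUnits
  dense_right := dense_span_matrixUnits
  dense_tensor := dense_span_matrixUnits_tensor
  eigen_left := matrixUnits_isEigenvector F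
  eigen_right := matrixUnits_isEigenvector F'
  diag_or_offdiag := matrixUnits_diag_or_offdiag F

theorem isDiagonal_of_mem_kmsStates {F : Br.Potential} {β : ℝ} {ω : CStarDual Br.AF}
    (hω : ω ∈ kmsStates (gaugeAction F) β) : IsDiagonal ω :=
  fun _ _ _ h hne => kmsStates_apply_matrixUnit_of_ne hω h hne

theorem IsTensorGaugeFlow.eq_tensorFlow {F : Br.Potential} {F' : Br'.Potential}
    {α : CStarFlow (spatialTensor Br.AF Br'.AF)} (hα : IsTensorGaugeFlow F F' α) :
    α = tensorFlow F F' := by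
  refine CStarFlow.ext_of_dense_span dense_span_matrixUnits_tensor ?_
  rintro t _ ⟨a, -, b, -, rfl⟩
  exact (hα t a b).trans (isTensorGaugeFlow_tensorFlow F F' t a b).symm

theorem isGeneralizedGaugeAction_tensorFlow (F : Br.Potential) (F' : Br'.Potential) :
    IsGeneralizedGaugeAction (tensorFlow F F') :=
  ⟨prod Br Br', diffPotential F F', tensorEquivAF Br Br',
    CStarFlow.apply_transport (gaugeAction (diffPotential F F')) (tensorEquivAF Br Br')⟩

end BratteliDiagram

theorem lemma5p4 (Br Br' : BratteliDiagram) (F : Br.Potential) (F' : Br'.Potential) :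
    (∃! α : CStarFlow (spatialTensor Br.AF Br'.AF), ∀ (t : ℝ) (a : Br.AF) (b : Br'.AF),
      α t (elemTensor a b) = elemTensor (BratteliDiagram.gaugeAction F t a)
        (BratteliDiagram.gaugeAction F' (-t) b)) ∧
    ∀ α : CStarFlow (spatialTensor Br.AF Br'.AF),
      (∀ (t : ℝ) (a : Br.AF) (b : Br'.AF),
        α t (elemTensor a b) = elemTensor (BratteliDiagram.gaugeAction F t a)
          (BratteliDiagram.gaugeAction F' (-t) b)) →
      IsGeneralizedGaugeAction α ∧
      ∀ (β : ℝ) (ω' : WeakDual ℂ Br'.AF),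
        kmsStates (BratteliDiagram.gaugeAction F') (-β) = {ω'} →
        ∃ Φ : kmsStates (BratteliDiagram.gaugeAction F) β ≃ₜ kmsStates α β,
          (∀ (ω : kmsStates (BratteliDiagram.gaugeAction F) β) (a : Br.AF) (b : Br'.AF),
            (Φ ω : WeakDual ℂ (spatialTensor Br.AF Br'.AF)) (elemTensor a b)
              = (ω : WeakDual ℂ Br.AF) a * ω' b) ∧
          IsAffineMapOn (convex_kmsStates (BratteliDiagram.gaugeAction F) β) Φ := by
  refine ⟨⟨BratteliDiagram.tensorFlow F F',
    BratteliDiagram.isTensorGaugeFlow_tensorFlow F F',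
    fun α hα => BratteliDiagram.IsTensorGaugeFlow.eq_tensorFlow hα⟩, fun α hα => ⟨?_, ?_⟩⟩
  · rw [BratteliDiagram.IsTensorGaugeFlow.eq_tensorFlow hα]
    exact BratteliDiagram.isGeneralizedGaugeAction_tensorFlow F F'
  · intro β ω' hω'
    have hmem : ω' ∈ kmsStates (BratteliDiagram.gaugeAction F') (-β) := hω' ▸ rfl
    exact (BratteliDiagram.IsTensorGaugeFlow.isTensorFlow hα).exists_homeomorph_kmsStates hω'
      fun ω hω => BratteliDiagram.exists_isState_elemTensor hω.1 hmem.1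
        (BratteliDiagram.isDiagonal_of_mem_kmsStates hω)
        (BratteliDiagram.isDiagonal_of_mem_kmsStates hmem)
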